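/- **Conventions.** Let $R$ be a commutative unital ring. Graphs are finite, simple, connected, and bidirected (each edge carries both orientations). A cut-vertex is a vertex whose removal disconnects the graph; the strong blocks are the maximal connected subgraphs without cut-vertices. $J$ is the all-ones matrix, ${\bf e}$ the all-ones vector, $[p]=\{1,\dots,p\}$, and ${\rm cof}(A)={\bf e}^T{\rm adj}(A){\bf e}$ is the sum of all cofactors of a square matrix $A$. Let the strong blocks $G_e$ of a graph $G$ be equipped with scalars $a_e\in R$ and matrices $D^*_{G_e}$ over $R$, indexed by the nodes of $G_e$, with all diagonal entries $1$. The multiplicative distance matrix $D^*_G=(m_{ij})$ has principal submatrices $D^*_{G_e}$, and $m_{ij}=m_{iv}m_{vj}$ whenever $v$ is a cut-vertex separating $i$ from $j$. The additive-multiplicative distance matrix $D_{\mathcal G}=(d_{ij})$ has principal submatrices $D_{\mathcal G_e}=a_e(D^*_{G_e}-J)$, and $d_{ij}=d_{iv}+m_{iv}d_{vj}$ for such $v$. (For a one-vertex graph, $D^*_G=(1)$ and $D_{\mathcal G}=(0)$.) For a vertex $v_0$ put $$\kappa(D_{\mathcal G},v_0)=\det\big(d_{vw}-d_{vv_0}-m_{vv_0}d_{v_0w}\big)_{v,w\neq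 v_0}.$$ **Proposition.** Let $k,p'_1,\dots,p'_k\ge1$ be integers. For $j\in[k]$ let $G_j$ be a connected bidirected graph on $[p'_j]$ without cut-vertices, with datum $(a_j,D^*_{G_j})$, such that $D_{\mathcal G_j}{\bf e}=d_j{\bf e}$ for a scalar $d_j\in R$, where $D_{\mathcal G_j}=a_j(D^*_{G_j}-J)$. Let $G'$ be any connected graph with strong blocks $G_1,\dots,G_k$, and let $G$ be obtained from $G'$ by inductively attaching finitely many cliques $G_e=K_{p_e}$, $e\in E$, $p_e\ge2$, each along exactly one vertex of the graph constructed so far. Let the clique $G_e$ have datum $a_e$, $m_{e,v},m'_{e,v}$ ($v\in[p_e]$), i.e. $(D^*_{G_e})_{vw}=m_{e,v}m'_{e,w}$ for $v\ne w$, and $1$ on the diagonal. Write $$\delta_e=\sum_{v}\frac{m_{e,v}m'_{e,v}}{1-m_{e,v}m'_{e,v}},\qquad S_e=p_e-1+\sum_{v<w}\frac{(m_{e,v}-m_{e,w})(m'_{e,v}-m'_{e,w})}{(1-m_{e,v}m'_{e,v})(1-m_{e,w}m'_{e,w})},$$ $$K=\prod_{j=1}^k\det(D_{\mathcal G_j})\Big(\frac1{a_j}+\frac{p'_j}{d_j}\Big)\prod_{e\in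 E}\Big(a_e^{p_e-1}(1+\delta_e)\prod_{v\in[p_e]}(1-m_{e,v}m'_{e,v})\Big).$$ Then: 1. If $a_j$, $d_j$, $1+a_jp'_j/d_j$, $1-m_{e,v}m'_{e,v}$ and $1+\delta_e$ are units for all $j\in[k]$, $e\in E$, $v\in[p_e]$, then $\kappa(D_{\mathcal G},v_0)=K$ for every vertex $v_0$ of $G$, and $${\rm cof}(D_{\mathcal G})=K\Big[1-\sum_{j=1}^k\frac{1}{1+\frac{a_jp'_j}{d_j}}+\sum_{e\in E}\frac{S_e}{1+\delta_e}\Big],$$ $$\det(D_{\mathcal G}+xJ)=K\Big[x+\sum_{j=1}^k\frac{a_j-x}{1+\frac{a_jp'_j}{d_j}}+\sum_{e\in E}\frac{x-a_e}{1+\delta_e}\,S_e\Big]\qquad\text{for all }x\in R.$$ 2. With no invertibility assumption, the same formulas hold with the denominators cancelled. Namely, put $\kappa_j=a_j^{p'_j-1}\det D^*_{G_j}$ (for $\det(D_{\mathcal G_j})(\frac1{a_j}+\frac{p'_j}{d_j})$), $\rho_j=a_j^{p'_j-1}\det(D^*_{G_j}-J)$ (for $\kappa_j/(1+\frac{a_jp'_j}{d_j})$),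 and, with $t_{e,v}=1-m_{e,v}m'_{e,v}$, $$\kappa_e=a_e^{p_e-1}\Big(\prod_{v}t_{e,v}+\sum_vm_{e,v}m'_{e,v}\prod_{w\ne v}t_{e,w}\Big),$$ $$\sigma_e=a_e^{p_e-1}\Big((p_e-1)\prod_vt_{e,v}+\sum_{v<w}(m_{e,v}-m_{e,w})(m'_{e,v}-m'_{e,w})\prod_{u\ne v,w}t_{e,u}\Big).$$ Then $a_j\rho_j=\det D_{\mathcal G_j}$, $d_j\kappa_j=(d_j+a_jp'_j)\rho_j$, and for every vertex $v_0$ of $G$ and all $x\in R$ $$\kappa(D_{\mathcal G},v_0)=\prod_{j}\kappa_j\prod_{e}\kappa_e,$$ $${\rm cof}(D_{\mathcal G})=\prod_j\kappa_j\prod_e\kappa_e-\sum_j\rho_j\prod_{i\ne j}\kappa_i\prod_e\kappa_e+\prod_j\kappa_j\sum_e\sigma_e\prod_{f\ne e}\kappa_f,$$ $$\det(D_{\mathcal G}+xJ)=x\prod_j\kappa_j\prod_e\kappa_e+\sum_j(a_j-x)\rho_j\prod_{i\ne j}\kappa_i\prod_e\kappa_e+\prod_j\kappa_j\sum_e(x-a_e)\sigma_e\prod_{f\ne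 e}\kappa_f.$$ 3. Consequently $\det(D_{\mathcal G})$, ${\rm cof}(D_{\mathcal G})$ and $\kappa(D_{\mathcal G},v_0)$ depend only on the block-data, and not on the structure and locations of the blocks $G_j$ and of the attached cliques, nor on $v_0$: any two graphs obtained in this way from the same block-data have the same three invariants. -/

import Mathlib

open scoped Matrix

namespace AddMultDist

universe u w

/-! ### Graphs, strong blocks, separating vertices

All graphs are finite and bidirected (every edge carries both orientations), i.e. they are
instances of `SimpleGraph`; for those, strongly connected means connected. -/

/-- The graph has no cut-vertex: removing any vertex does not disconnect it. -/
def NoCutVertex {V : Type*} (G : SimpleGraph V) : Prop :=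
  ∀ v : V, (G.induce ({v}ᶜ : Set V)).Preconnected

/-- The vertex sets of the strong blocks of `G`: the maximal sets which induce a connected
subgraph without cut-vertices. -/
def IsStrongBlock {V : Type*} (G : SimpleGraph V) (B : Set V) : Prop :=
  Maximal (fun S : Set V => (G.induce S).Connected ∧ NoCutVertex (G.induce S)) B

/-- `v` is a cut-vertex between `i` and `j`: it is distinct from both, and `i` and `j` lie in one
component of `G` but in different components of `G - v`. -/
def Separates {V : Type*} (G : SimpleGraph V) (v i j : V) : Prop :=
  v ≠ i ∧ v ≠ j ∧ G.Reachable i j ∧ ∀ w : G.Walk i j, v ∈ w.support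

theorem Separates.dist_lt {V : Type*} {G : SimpleGraph V} {v i j : V} (h : Separates G v i j) :
    G.dist i v < G.dist i j ∧ G.dist v j < G.dist i j := by
  classical
  obtain ⟨hi, hj, hr, hw⟩ := h
  obtain ⟨w, hwl⟩ := hr.exists_walk_length_eq_dist
  have hv := hw w
  have h1 := SimpleGraph.dist_le (w.takeUntil v hv)
  have h2 := SimpleGraph.dist_le (w.dropUntil v hv)
  have h3 : (w.takeUntil v hv).length + (w.dropUntil v hv).length = w.length := by
    rw [← SimpleGraph.Walk.length_append, SimpleGraph.Walk.take_spec]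
  have h4 : 0 < G.dist i v := (w.takeUntil v hv).reachable.pos_dist_of_ne hi.symm
  have h5 : 0 < G.dist v j := (w.dropUntil v hv).reachable.pos_dist_of_ne hj
  omega

/-! ### Block-data -/

/-- The additive-multiplicative datum of one strong block with node set `Fin size`: a scalar `a`
and a matrix `D*` with all diagonal entries `1`. -/
structure BlockDatum (R : Type*) [CommRing R] where
  size : ℕ
  a : R
  Dstar : Matrix (Fin size) (Fin size) R
  diag : ∀ v, Dstar v v = 1

/-- The all-ones matrix `J`. -/
def allOnes (n R : Type*) [One R] : Matrix n n R := Matrix.of fun _ _ => 1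

/-- The sum of all cofactors of a square matrix, `cof A = eᵀ adj(A) e`. -/
def cofSum {n R : Type*} [Fintype n] [DecidableEq n] [CommRing R] (A : Matrix n n R) : R :=
  ∑ i, ∑ j, A.adjugate i j

namespace BlockDatum

variable {R : Type*} [CommRing R] (B : BlockDatum R)

/-- The additive-multiplicative distance matrix `a (D* - J)` of a single block. -/
def D : Matrix (Fin B.size) (Fin B.size) R := B.a • (B.Dstar - allOnes _ R)

/-- `a ^ (p - 1) det D*`, the value of `det(D) (1 / a + p / d)` without its denominators. -/
def kappa : R := B.a ^ (B.size - 1) * B.Dstar.det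

/-- `a ^ (p - 1) det (D* - J)`, i.e. `det(D) / a`: the value of
`det(D) (1 / a + p / d) / (1 + a p / d)` without its denominators. -/
def rho : R := B.a ^ (B.size - 1) * (B.Dstar - allOnes _ R).det

end BlockDatum

/-- The block-data of a clique `K_p`: scalars `a`, `m v`, `m' v` for `v ∈ [p]`. -/
structure CliqueDatum (R : Type*) [CommRing R] where
  size : ℕ
  a : R
  m : Fin size → R
  m' : Fin size → R

namespace CliqueDatum

variable {R : Type*} [CommRing R] (C : CliqueDatum R)

/-- The clique as a block: `D*` has entry `m v * m' w` at `v ≠ w`, and `1` on the diagonal. -/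
def toBlockDatum : BlockDatum R where
  size := C.size
  a := C.a
  Dstar := Matrix.of fun v w => if v = w then 1 else C.m v * C.m' w
  diag := by simp

/-- `a ^ (p - 1) (1 + eᵀ d) ∏ v, (1 - m v * m' v)`, with `d v = m v * m' v / (1 - m v * m' v)`,
after cancelling the denominators. -/
def kappa : R :=
  C.a ^ (C.size - 1) *
    ((∏ v, (1 - C.m v * C.m' v)) +
      ∑ v, C.m v * C.m' v * ∏ w ∈ Finset.univ.erase v, (1 - C.m w * C.m' w))

/-- `a ^ (p - 1) ∏ v, (1 - m v * m' v)` times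
`p - 1 + ∑_{v < w} (m v - m w) (m' v - m' w) / ((1 - m v * m' v) (1 - m w * m' w))`,
after cancelling the denominators. -/
def sigma : R :=
  C.a ^ (C.size - 1) *
    (((C.size : R) - 1) * (∏ v, (1 - C.m v * C.m' v)) +
      ∑ v, ∑ w ∈ Finset.Ioi v, (C.m v - C.m w) * (C.m' v - C.m' w) *
        ∏ u ∈ (Finset.univ.erase v).erase w, (1 - C.m u * C.m' u))

/-- `eᵀ d`, where `d v = m v * m' v / (1 - m v * m' v)`; meant for `1 - m v * m' v` invertible. -/
noncomputable def sumD : R :=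
  ∑ v, C.m v * C.m' v * Ring.inverse (1 - C.m v * C.m' v)

/-- `p - 1 + ∑_{v < w} (m v - m w) (m' v - m' w) / ((1 - m v * m' v) (1 - m w * m' w))`; meant
for `1 - m v * m' v` invertible. -/
noncomputable def sumS : R :=
  ((C.size : R) - 1) +
    ∑ v, ∑ w ∈ Finset.Ioi v, (C.m v - C.m w) * (C.m' v - C.m' w) *
      (Ring.inverse (1 - C.m v * C.m' v) * Ring.inverse (1 - C.m w * C.m' w))

end CliqueDatum

/-! ### The distance matrices of a graph with block-data

The strong blocks of `G` are given by their labellings `φ e : Fin p_e → V`. Two nodes of `G` that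
lie in no common strong block are separated by a cut-vertex `v`; the entries do not depend on the
`v` that is used. -/

section Distance

variable {V ι R : Type*} [CommRing R]

/-- `i` and `j` are the nodes labelled `x.2.1` and `x.2.2` of the block `x.1`. -/
def IsLabel {𝒢 : ι → BlockDatum R} (φ : ∀ e, Fin (𝒢 e).size → V) (i j : V)
    (x : Σ e, Fin (𝒢 e).size × Fin (𝒢 e).size) : Prop :=
  φ x.1 x.2.1 = i ∧ φ x.1 x.2.2 = j

open Classical in
/-- The entry `m i j` of the multiplicative distance matrix `D*_G`: the entry of `D*_{G_e}` if `i`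
and `j` lie in the strong block `G_e`, and `m i v * m v j` for a cut-vertex `v` between `i` and `j`
otherwise. -/
noncomputable def multDist (G : SimpleGraph V) (𝒢 : ι → BlockDatum R)
    (φ : ∀ e, Fin (𝒢 e).size → V) (i j : V) : R :=
  if i = j then 1
  else if h : ∃ x, IsLabel φ i j x then
    (𝒢 h.choose.1).Dstar h.choose.2.1 h.choose.2.2
  else if h : ∃ v, Separates G v i j then
    have := h.choose_spec.dist_lt
    multDist G 𝒢 φ i h.choose * multDist G 𝒢 φ h.choose j
  else 0
termination_by G.dist i j
decreasing_by
  · exact h.choose_spec.dist_lt.1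
  · exact h.choose_spec.dist_lt.2

open Classical in
/-- The entry `d i j` of the additive-multiplicative distance matrix `D_𝒢`: the entry of
`a_e (D*_{G_e} - J)` if `i` and `j` lie in the strong block `G_e`, and `d i v + m i v * d v j` for a
cut-vertex `v` between `i` and `j` otherwise. -/
noncomputable def addMultDist (G : SimpleGraph V) (𝒢 : ι → BlockDatum R)
    (φ : ∀ e, Fin (𝒢 e).size → V) (i j : V) : R :=
  if i = j then 0
  else if h : ∃ x, IsLabel φ i j x then
    (𝒢 h.choose.1).D h.choose.2.1 h.choose.2.2
  else if h : ∃ v, Separates G v i j then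
    have := h.choose_spec.dist_lt
    addMultDist G 𝒢 φ i h.choose + multDist G 𝒢 φ i h.choose * addMultDist G 𝒢 φ h.choose j
  else 0
termination_by G.dist i j
decreasing_by
  · exact h.choose_spec.dist_lt.1
  · exact h.choose_spec.dist_lt.2

/-- The invariant `κ(D, v₀) = det (D|_{V \ v₀} - u eᵀ - m(V \ v₀, v₀) wᵀ)`, where `u` and `wᵀ` are
the column and the row of `D` at `v₀` (without the entry at `v₀`), and `m` is the multiplicative
distance. -/
def kappaAt [Fintype V] [DecidableEq V] (M D : Matrix V V R) (v₀ : V) : R :=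
  (Matrix.of fun v w : {v : V // v ≠ v₀} => D v w - D v v₀ - M v v₀ * D v₀ w).det

end Distance

/-! ### Attaching cliques -/

/-- A graph `G` obtained from a graph `G₀`, whose strong blocks are `k` given labelled graphs
`H j` with node sets `Fin (p j)`, by inductively attaching cliques on `q e` nodes, `e ∈ E`, each
one along a single vertex of the graph constructed so far. -/
structure CliqueExtension {k : ℕ} (p : Fin k → ℕ) {E : Type w} [Fintype E] (q : E → ℕ) :
    Type (max (u + 1) w) where
  /-- the blocks of `G₀` -/
  H : ∀ j, SimpleGraph (Fin (p j))
  H_connected : ∀ j, (H j).Connected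
  H_noCutVertex : ∀ j, NoCutVertex (H j)
  /-- the graph `G₀` and the position of its blocks in it (as induced subgraphs) -/
  V₀ : Type u
  G₀ : SimpleGraph V₀
  G₀_connected : G₀.Connected
  emb : ∀ j, H j ↪g G₀
  emb_isStrongBlock : ∀ j, IsStrongBlock G₀ (Set.range (emb j))
  emb_injective : Function.Injective fun j => Set.range (emb j)
  emb_surjective : ∀ B, IsStrongBlock G₀ B → ∃ j, Set.range (emb j) = B
  /-- the final graph, the copy of `G₀` in it, and the attached cliques -/
  V : Type u
  [fintypeV : Fintype V]
  [decidableEqV : DecidableEq V]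
  G : SimpleGraph V
  base : V₀ ↪ V
  clique : ∀ e, Fin (q e) ↪ V
  /-- the order in which the cliques are attached -/
  order : E ≃ Fin (Fintype.card E)
  /-- each clique meets the graph constructed before in exactly one vertex -/
  attach : ∀ e, ∃ v, (Set.range base ∪ ⋃ f, ⋃ _ : order f < order e, Set.range (clique f)) ∩
    Set.range (clique e) = {v}
  cover : Set.range base ∪ ⋃ e, Set.range (clique e) = Set.univ
  /-- the edges of `G` are those of `G₀` and those of the cliques -/
  adj_iff : ∀ x y, G.Adj x y ↔ (∃ s t, G₀.Adj s t ∧ base s = x ∧ base t = y) ∨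
    (x ≠ y ∧ ∃ e, x ∈ Set.range (clique e) ∧ y ∈ Set.range (clique e))

attribute [instance] CliqueExtension.fintypeV CliqueExtension.decidableEqV

/-- The block-data of all blocks: those of `G₀`, and the attached cliques. -/
def allData {R : Type*} [CommRing R] {k : ℕ} (𝓑 : Fin k → BlockDatum R) {E : Type*}
    (𝓒 : E → CliqueDatum R) : Fin k ⊕ E → BlockDatum R
  | .inl j => 𝓑 j
  | .inr e => (𝓒 e).toBlockDatum

namespace CliqueExtension

variable {R : Type*} [CommRing R] {k : ℕ} {𝓑 : Fin k → BlockDatum R} {E : Type w} [Fintype E]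
  {𝓒 : E → CliqueDatum R}
  (X : CliqueExtension.{u, w} (fun j => (𝓑 j).size) (fun e => (𝓒 e).size))

/-- The labellings in `G` of the blocks of `G₀` and of the attached cliques. -/
def labels : ∀ i : Fin k ⊕ E, Fin (allData 𝓑 𝓒 i).size → X.V
  | .inl j => fun s => X.base (X.emb j s)
  | .inr e => fun s => X.clique e s

/-- The multiplicative distance matrix `D*_G`. -/
noncomputable def Dstar : Matrix X.V X.V R :=
  Matrix.of fun i j => multDist X.G (allData 𝓑 𝓒) X.labels i j

/-- The additive-multiplicative distance matrix `D_𝒢` of `G`. -/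
noncomputable def D : Matrix X.V X.V R :=
  Matrix.of fun i j => addMultDist X.G (allData 𝓑 𝓒) X.labels i j

end CliqueExtension

end AddMultDist

/-! For a vertex `v` let `reduced M D v` have the entries `D i j - D i v - M i v * D v j`. The
additive rule at a cut-vertex `v` says exactly that such an entry vanishes when `v` separates `i`
from `j`, so gluing at `v` shows up as zero blocks. The invariant κ is a principal minor of this
matrix. One round of row and column operations also turns `D + x J` into the same matrix, bordered
by a row and a column at `v`.

Let `f(S)` be the principal minor of `D + x J` on `S`, and let `A`, `B` be glued at `v`. Then κ is
multiplicative, and expanding the bordered matrix along its row `v` gives `f(A ∪ B) = f(A) κ(B) +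
κ(A) (f(B) - x κ(B))`. When κ is invertible this says that `f / κ - x` is additive; without division
it is a Leibniz rule. Moving the base point of κ costs only a block triangular elimination, so κ
does not depend on it. A single block has `κ = a ^ (p - 1) det D*`, by a Schur complement, and `f =
x κ + (a - x) ρ`, by the matrix determinant lemma. Induction over a tree of blocks
(`BlockTree.invariants`) gives all formulas; the cofactor sum is the difference of `f` at `x = 1`
and `x = 0`.

The graph theory supplies two inputs. The blocks form such a tree: the base graph is split at
cut-vertices (`blockTree_of_setPreconnected`), and each clique is then glued on at one vertex. The
recursively defined distances obey their rules at every cut-vertex, not only the chosen one, because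
two separators of `i` and `j` are passed in a fixed order (`Separates.order`, `distance_rules`).

For a clique, `D*` is diagonal plus rank one and `D* - J` is diagonal plus rank two, so κ and ρ
reduce to determinants of size one and two. This is done for invertible `1 - m v * m' v` and
transferred to every ring through generic entries. The row sums `d j` serve only to relate ρ, κ and
`det D` of the given blocks. The formulas with denominators then follow from the cancelled ones, and
since these involve the block-data alone, independence of the graph is immediate. -/

namespace AddMultDist

/-! ### Principal minors -/

section PrincipalMinor

variable {V R : Type*} [Finite V] [CommRing R]

open Classical in
/-- The principal minor of `A` with rows and columns in `S`. -/
noncomputable def principalMinor (A : Matrix V V R) (S : Set V) : R :=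
  letI := Fintype.ofFinite S
  (A.submatrix (Subtype.val : S → V) Subtype.val).det

theorem principalMinor_range {α : Type*} [Fintype α] [DecidableEq α] (A : Matrix V V R)
    {f : α → V} (hf : Function.Injective f) :
    principalMinor A (Set.range f) = (A.submatrix f f).det := by
  classical
  let := Fintype.ofFinite (Set.range f)
  unfold principalMinor
  rw [← Matrix.det_submatrix_equiv_self (Equiv.ofInjective f hf)]
  rfl

theorem principalMinor_univ [Fintype V] [DecidableEq V] (A : Matrix V V R) :
    principalMinor A Set.univ = A.det := by
  rw [← Set.range_id, principalMinor_range A Function.injective_id]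
  rfl

theorem principalMinor_congr {A B : Matrix V V R} {S : Set V}
    (h : ∀ i ∈ S, ∀ j ∈ S, A i j = B i j) : principalMinor A S = principalMinor B S := by
  unfold principalMinor
  congr 1
  ext i j
  exact h i i.2 j j.2

theorem principalMinor_transpose (A : Matrix V V R) (S : Set V) :
    principalMinor Aᵀ S = principalMinor A S := by
  classical
  let := Fintype.ofFinite S
  unfold principalMinor
  rw [← Matrix.det_transpose]
  rfl

theorem principalMinor_empty (A : Matrix V V R) : principalMinor A ∅ = 1 := by
  classical
  let := Fintype.ofFinite (∅ : Set V)
  unfold principalMinor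
  convert! Matrix.det_isEmpty
  infer_instance

theorem principalMinor_singleton (A : Matrix V V R) (v : V) :
    principalMinor A {v} = A v v := by
  have := principalMinor_range A (f := fun _ : Unit => v) (fun _ _ _ => rfl)
  rw [Set.range_const] at this
  rw [this, Matrix.det_unique]
  rfl

theorem principalMinor_smul (a : R) (A : Matrix V V R) (S : Set V) :
    principalMinor (a • A) S = a ^ S.ncard * principalMinor A S := by
  classical
  let := Fintype.ofFinite S
  unfold principalMinor
  rw [Matrix.submatrix_smul, Pi.smul_apply, Pi.smul_apply, Matrix.det_smul, ← Nat.card_coe_set_eq,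
    Nat.card_eq_fintype_card]

theorem principalMinor_union {A : Matrix V V R} {S T : Set V} (hST : Disjoint S T)
    (h : ∀ i ∈ T, ∀ j ∈ S, A i j = 0) :
    principalMinor A (S ∪ T) = principalMinor A S * principalMinor A T := by
  classical
  let := Fintype.ofFinite S
  let := Fintype.ofFinite T
  have hinj : Function.Injective (Sum.elim (Subtype.val : S → V) (Subtype.val : T → V)) := by
    refine Subtype.val_injective.sumElim Subtype.val_injective fun a b hab => ?_
    exact Set.disjoint_left.1 hST a.2 (hab ▸ b.2)
  have hr : S ∪ T = Set.range (Sum.elim (Subtype.val : S → V) (Subtype.val : T → V)) := by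
    simp [Set.Sum.elim_range]
  rw [hr, principalMinor_range A hinj]
  unfold principalMinor
  rw [← Matrix.det_fromBlocks_zero₂₁ _
    (A.submatrix (Subtype.val : S → V) (Subtype.val : T → V)) _]
  congr 1
  ext (i | i) (j | j)
  · rfl
  · rfl
  · exact h i i.2 j j.2
  · rfl

theorem principalMinor_eq_of_row {A B : Matrix V V R} {S : Set V} {k : V} (hk : k ∈ S)
    (c : V → R) (hc : c k = 0)
    (h : ∀ i ∈ S, ∀ j ∈ S, A i j = B i j + c i * B k j) :
    principalMinor A S = principalMinor B S := by
  classical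
  let := Fintype.ofFinite S
  unfold principalMinor
  exact Matrix.det_eq_of_forall_row_eq_smul_add_const (fun i => c i) ⟨k, hk⟩ hc
    fun i j => h i i.2 j j.2

theorem principalMinor_eq_of_col {A B : Matrix V V R} {S : Set V} {k : V} (hk : k ∈ S)
    (c : V → R) (hc : c k = 0)
    (h : ∀ i ∈ S, ∀ j ∈ S, A i j = B i j + c j * B i k) :
    principalMinor A S = principalMinor B S := by
  rw [← principalMinor_transpose A, ← principalMinor_transpose B]
  exact principalMinor_eq_of_row hk c hc fun i hi j hj => h j hj i hi

theorem principalMinor_row_add {A B C : Matrix V V R} {S : Set V} {k : V} (hk : k ∈ S)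
    (h : ∀ j ∈ S, A k j = B k j + C k j)
    (hB : ∀ i ∈ S, i ≠ k → ∀ j ∈ S, A i j = B i j)
    (hC : ∀ i ∈ S, i ≠ k → ∀ j ∈ S, A i j = C i j) :
    principalMinor A S = principalMinor B S + principalMinor C S := by
  classical
  let := Fintype.ofFinite S
  unfold principalMinor
  have key : ∀ F : Matrix V V R, (∀ i ∈ S, i ≠ k → ∀ j ∈ S, A i j = F i j) →
      F.submatrix (Subtype.val : S → V) (Subtype.val : S → V) =
        (A.submatrix Subtype.val Subtype.val).updateRow ⟨k, hk⟩ (fun j : S => F k j) := by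
    intro F hF
    ext i j
    by_cases hi : i = ⟨k, hk⟩
    · subst hi; simp
    · rw [Matrix.updateRow_ne hi]
      exact (hF i i.2 (fun h => hi (Subtype.ext h)) j j.2).symm
  rw [key A fun _ _ _ _ _ => rfl, key B hB, key C hC, ← Matrix.det_updateRow_add]
  congr 2
  ext j
  exact h j j.2

end PrincipalMinor

/-! ### Gluing two distance matrices along one node -/

section Glue

variable {V R : Type*} [CommRing R]

/-- The matrix `D - u eᵀ - m wᵀ`, where `u`, `wᵀ` are the column and the row of `D` at `v`, and
`m` is the column of `M` at `v`. -/
def reduced (M D : Matrix V V R) (v : V) : Matrix V V R :=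
  Matrix.of fun i j => D i j - D i v - M i v * D v j

open Classical in
/-- The matrix `D + x J` after clearing, by one row and one column operation, the contribution of
the node `v` to all other rows and columns. -/
noncomputable def bordered (M D : Matrix V V R) (x : R) (v : V) : Matrix V V R :=
  Matrix.of fun i j => if i = v then (if j = v then x else D v j)
    else if j = v then D i v + x * (1 - M i v) else reduced M D v i j

theorem bordered_ne {M D : Matrix V V R} {x : R} {v i j : V} (hi : i ≠ v) (hj : j ≠ v) :
    bordered M D x v i j = reduced M D v i j := by simp [bordered, hi, hj]

variable [Finite V]

/-- Subtract `M i v` times row `v` from each other row `i`, then column `v` from each other column.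
Since `D v v = 0`, the corner is `x` and the border column is unaffected by the reduced part. -/
theorem principalMinor_bordered {M D : Matrix V V R} {v : V} (hD : D v v = 0)
    {S : Set V} (hv : v ∈ S) (x : R) :
    principalMinor (D + x • allOnes V R) S = principalMinor (bordered M D x v) S := by
  classical
  let B : Matrix V V R := Matrix.of fun i j => if i = v then D v j + x
    else reduced M D v i j + D i v + x * (1 - M i v)
  trans principalMinor B S
  · refine principalMinor_eq_of_row hv (fun i => if i = v then 0 else M i v) (by simp) ?_
    intro i _ j _
    by_cases hi : i = v
    · simp [B, hi, allOnes]
    · simp only [B, hi, allOnes, reduced, Matrix.add_apply, Matrix.smul_apply, Matrix.of_apply,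
        if_true, if_false, smul_eq_mul]
      ring
  · refine principalMinor_eq_of_col hv (fun j => if j = v then 0 else 1) (by simp) ?_
    intro i _ j _
    by_cases hi : i = v <;> by_cases hj : j = v <;> simp [B, bordered, reduced, hi, hj, hD]
    ring

/-- `A` and `B` share the node `v`, which behaves like a cut-vertex between `A` and `B`. -/
structure GluedAt (M D : Matrix V V R) (v : V) (A B : Set V) : Prop where
  inter : A ∩ B = {v}
  mult : ∀ i ∈ A, ∀ j ∈ B, M i j = M i v * M v j
  add : ∀ i ∈ A, ∀ j ∈ B, D i j = D i v + M i v * D v j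

variable {M D : Matrix V V R} {v : V} {A B : Set V}

omit [Finite V] in
theorem GluedAt.mem_left (h : GluedAt M D v A B) : v ∈ A :=
  (h.inter.symm ▸ rfl : v ∈ A ∩ B).1

omit [Finite V] in
theorem GluedAt.mem_right (h : GluedAt M D v A B) : v ∈ B :=
  (h.inter.symm ▸ rfl : v ∈ A ∩ B).2

omit [Finite V] in
theorem GluedAt.reduced_eq_zero (h : GluedAt M D v A B) {i j : V} (hi : i ∈ A) (hj : j ∈ B) :
    reduced M D v i j = 0 := by
  simp [reduced, h.add i hi j hj]

theorem GluedAt.principalMinor_reduced_self (h : GluedAt M D v A B) (h' : GluedAt M D v B A) :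
    principalMinor (reduced M D v) ((A ∪ B) \ {v}) =
      principalMinor (reduced M D v) (A \ {v}) * principalMinor (reduced M D v) (B \ {v}) := by
  rw [Set.union_sdiff_distrib]
  refine principalMinor_union ?_ fun i hi j hj => h'.reduced_eq_zero hi.1 hj.1
  rw [Set.disjoint_left]
  rintro x ⟨hx, hv⟩ ⟨hx', -⟩
  exact hv (h.inter ▸ ⟨hx, hx'⟩ : x ∈ ({v} : Set V))

/-- This moves the base point from the gluing node `v` to any `u` in `A`. Subtracting `M i v` times
row `v` from the rows `i` of `B \ {v}` kills their entries in the columns of `A` and leaves the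
matrix reduced at `v` on `B \ {v}`. The result `N` is block triangular; its upper right block need
not vanish. -/
theorem GluedAt.principalMinor_reduced_left (h : GluedAt M D v A B) (h' : GluedAt M D v B A)
    {u : V} (hu : u ∈ A) :
    principalMinor (reduced M D u) ((A ∪ B) \ {u}) =
      principalMinor (reduced M D u) (A \ {u}) * principalMinor (reduced M D v) (B \ {v}) := by
  classical
  by_cases huv : u = v
  · subst huv; exact h.principalMinor_reduced_self h'
  have hvA := h.mem_left
  have hinter : ∀ x ∈ A, x ∈ B → x = v := fun x hx hx' =>
    (h.inter ▸ ⟨hx, hx'⟩ : x ∈ ({v} : Set V))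
  have huB : u ∉ B := fun hB => huv (hinter u hu hB)
  have hS : (A ∪ B) \ {u} = (A \ {u}) ∪ (B \ {v}) := by
    ext x
    constructor
    · rintro ⟨hx | hx, hxu⟩
      · exact Or.inl ⟨hx, hxu⟩
      · by_cases hxv : x = v
        · exact Or.inl ⟨hxv ▸ hvA, hxu⟩
        · exact Or.inr ⟨hx, hxv⟩
    · rintro (⟨hx, hxu⟩ | ⟨hx, hxv⟩)
      · exact ⟨Or.inl hx, hxu⟩
      · exact ⟨Or.inr hx, fun hxu => huB (hxu ▸ hx)⟩
  let N : Matrix V V R := Matrix.of fun i j => if i ∈ A then reduced M D u i j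
    else if j ∈ A then 0 else reduced M D v i j
  have hvS : v ∈ (A ∪ B) \ {u} := ⟨Or.inl hvA, fun e => huv (Eq.symm e)⟩
  have hN : principalMinor (reduced M D u) ((A ∪ B) \ {u}) =
      principalMinor N ((A ∪ B) \ {u}) := by
    refine principalMinor_eq_of_row hvS (fun i => if i ∈ A then 0 else M i v) (if_pos hvA) ?_
    rintro i ⟨hi, hiu⟩ j ⟨hj, hju⟩
    by_cases hiA : i ∈ A
    · simp [N, hiA]
    have hiB : i ∈ B := hi.resolve_left hiA
    by_cases hjA : j ∈ A
    · simp only [N, hiA, hjA, hvA, reduced, Matrix.of_apply, if_true, if_false,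
        h'.add i hiB j hjA, h'.add i hiB u hu, h'.mult i hiB u hu]
      ring
    have hjB : j ∈ B := hj.resolve_left hjA
    simp only [N, hiA, hjA, hvA, reduced, Matrix.of_apply, if_true, if_false,
      h'.add i hiB u hu, h'.mult i hiB u hu, h.add u hu j hjB]
    ring
  rw [hN, hS, principalMinor_union]
  · congr 1
    · refine principalMinor_congr fun i hi j _ => ?_
      simp [N, hi.1]
    · refine principalMinor_congr fun i hi j hj => ?_
      have hi' : i ∉ A := fun hA => hi.2 (hinter i hA hi.1)
      have hj' : j ∉ A := fun hA => hj.2 (hinter j hA hj.1)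
      simp [N, hi', hj']
  · rw [Set.disjoint_left]
    exact fun x hx hx' => hx'.2 (hinter x hx.1 hx'.1)
  · intro i hi j hj
    have hi' : i ∉ A := fun hA => hi.2 (hinter i hA hi.1)
    simp [N, hi', hj.1]

/-- In the bordered matrix, `A \ {v}` and `B \ {v}` interact only through row and column `v`.
Splitting row `v` into its parts over `A` and over `B \ {v}` makes each summand block triangular.
The correction `x κ(B)` appears because the corner entry `x` is assigned to `A` and must not be
counted again in `B`. -/
theorem GluedAt.principalMinor_add_smul_allOnes (h : GluedAt M D v A B)
    (h' : GluedAt M D v B A) (hD : D v v = 0) (x : R) :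
    principalMinor (D + x • allOnes V R) (A ∪ B) =
      principalMinor (D + x • allOnes V R) A * principalMinor (reduced M D v) (B \ {v}) +
      principalMinor (reduced M D v) (A \ {v}) *
        (principalMinor (D + x • allOnes V R) B -
          x * principalMinor (reduced M D v) (B \ {v})) := by
  classical
  have hvA := h.mem_left
  have hvB := h.mem_right
  have hinter : ∀ x ∈ A, x ∈ B → x = v := fun x hx hx' =>
    (h.inter ▸ ⟨hx, hx'⟩ : x ∈ ({v} : Set V))
  rw [principalMinor_bordered hD (Or.inl hvA : v ∈ A ∪ B), principalMinor_bordered hD hvA,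
    principalMinor_bordered hD hvB]
  set E := bordered M D x v with hE
  have hEN : ∀ T : Set V, v ∉ T → principalMinor E T = principalMinor (reduced M D v) T :=
    fun T hT => principalMinor_congr fun i hi j hj =>
      bordered_ne (fun e => hT (e ▸ hi)) (fun e => hT (e ▸ hj))
  have hvd : ∀ T : Set V, v ∉ T \ {v} := fun T hT => hT.2 rfl
  rw [← hEN _ (hvd A), ← hEN _ (hvd B)]
  -- the parts of row `v` in `A` and in `B \ {v}`
  let E₁ : Matrix V V R := Matrix.of fun i j => if i = v ∧ j ∉ A then 0 else E i j
  let E₂ : Matrix V V R := Matrix.of fun i j => if i = v ∧ j ∈ A then 0 else E i j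
  -- Row `v` is cut down to its corner `x`. Within `B`, the rows `v` of `E₃` and `E₂` add up to that
  -- of `E`, which isolates the term `x κ(B)`.
  let E₃ : Matrix V V R := Matrix.of fun i j => if i = v ∧ j ≠ v then 0 else E i j
  have h0 : ∀ i ∈ A, ∀ j ∈ B, i ≠ v → j ≠ v → E i j = 0 := fun i hi j hj hiv hjv =>
    (bordered_ne hiv hjv).trans (h.reduced_eq_zero hi hj)
  have h0' : ∀ i ∈ B, ∀ j ∈ A, i ≠ v → j ≠ v → E i j = 0 := fun i hi j hj hiv hjv =>
    (bordered_ne hiv hjv).trans (h'.reduced_eq_zero hi hj)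
  have hne : ∀ F ∈ [E₁, E₂, E₃], ∀ i, i ≠ v → ∀ j, F i j = E i j := by
    intro F hF i hi j
    simp only [List.mem_cons, List.not_mem_nil, or_false] at hF
    rcases hF with rfl | rfl | rfl <;> simp [E₁, E₂, E₃, hi]
  have hsplit : principalMinor E (A ∪ B) =
      principalMinor E₁ (A ∪ B) + principalMinor E₂ (A ∪ B) := by
    refine principalMinor_row_add (Or.inl hvA) (fun j _ => ?_)
      (fun i _ hi j _ => (hne E₁ (by simp) i hi j).symm)
      (fun i _ hi j _ => (hne E₂ (by simp) i hi j).symm)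
    by_cases hj : j ∈ A <;> simp [E₁, E₂, hj]
  have h1 : principalMinor E₁ (A ∪ B) = principalMinor E A * principalMinor E (B \ {v}) := by
    have hS : A ∪ B = (B \ {v}) ∪ A := by
      ext y
      by_cases hy : y = v
      · subst hy; simp [hvA]
      · simp [hy, or_comm]
    rw [hS, principalMinor_union, mul_comm]
    · congr 1
      · refine principalMinor_congr fun i _ j hj => ?_
        simp [E₁, hj]
      · refine principalMinor_congr fun i hi j _ => ?_
        have : i ≠ v := hi.2
        simp [E₁, this]
    · rw [Set.disjoint_left]
      exact fun y hy hy' => hy.2 (hinter y hy' hy.1)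
    · intro i hi j hj
      have hjA : j ∉ A := fun hA => hj.2 (hinter j hA hj.1)
      by_cases hiv : i = v
      · simp [E₁, hiv, hjA]
      · simp [E₁, hiv, h0 i hi j hj.1 hiv hj.2]
  have h2 : principalMinor E₂ (A ∪ B) = principalMinor E (A \ {v}) * principalMinor E₂ B := by
    have hS : A ∪ B = (A \ {v}) ∪ B := by
      ext y
      by_cases hy : y = v
      · subst hy; simp [hvB]
      · simp [hy]
    rw [hS, principalMinor_union]
    · congr 1
      refine principalMinor_congr fun i hi j _ => ?_
      have : i ≠ v := hi.2
      simp [E₂, this]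
    · rw [Set.disjoint_left]
      exact fun y hy hy' => hy.2 (hinter y hy.1 hy')
    · intro i hi j hj
      by_cases hiv : i = v
      · simp [E₂, hiv, hj.1]
      · simp [E₂, hiv, h0' i hi j hj.1 hiv hj.2]
  have h3 : principalMinor E B = principalMinor E₃ B + principalMinor E₂ B := by
    refine principalMinor_row_add hvB (fun j hj => ?_)
      (fun i _ hi j _ => (hne E₃ (by simp) i hi j).symm)
      (fun i _ hi j _ => (hne E₂ (by simp) i hi j).symm)
    by_cases hjA : j ∈ A
    · have := hinter j hjA hj
      subst this
      simp [E₂, E₃, hvA]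
    · have : j ≠ v := fun e => hjA (e ▸ hvA)
      simp [E₂, E₃, hjA, this]
  have h4 : principalMinor E₃ B = x * principalMinor E (B \ {v}) := by
    have hS : B = (B \ {v}) ∪ {v} := by simp [hvB]
    conv_lhs => rw [hS]
    rw [principalMinor_union, principalMinor_singleton, mul_comm]
    · congr 1
      · simp [E₃, hE, bordered]
      · refine principalMinor_congr fun i hi j _ => ?_
        have : i ≠ v := hi.2
        simp [E₃, this]
    · simp
    · rintro i rfl j hj
      have : j ≠ i := hj.2
      simp [E₃, this]
  rw [hsplit, h1, h2, h3, h4]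
  ring

end Glue

/-! ### The determinant of `A + x J`, and single blocks -/

section Cofactors

variable {n R : Type*} [Fintype n] [DecidableEq n] [CommRing R]

theorem cofSum_map {S : Type*} [CommRing S] (f : R →+* S) (A : Matrix n n R) :
    cofSum (f.mapMatrix A) = f (cofSum A) := by
  simp only [cofSum, map_sum, ← RingHom.map_adjugate]
  rfl

theorem cofSum_smul (a : R) (A : Matrix n n R) :
    cofSum (a • A) = a ^ (Fintype.card n - 1) * cofSum A := by
  simp [cofSum, Matrix.adjugate_smul, Finset.mul_sum]

theorem det_add_smul_allOnes_of_isUnit {A : Matrix n n R} (hA : IsUnit A.det) (x : R) :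
    (A + x • allOnes n R).det = A.det + x * cofSum A := by
  have h1 : x • allOnes n R = Matrix.replicateCol Unit (fun _ => x) *
      Matrix.replicateRow Unit (fun _ : n => (1 : R)) := by
    ext i j
    simp [allOnes, Matrix.mul_apply]
  have h2 : cofSum A = A.det * ∑ i, ∑ j, A⁻¹ i j := by
    have : A.adjugate = A.det • A⁻¹ := by
      rw [Matrix.inv_def, smul_smul, Ring.mul_inverse_cancel _ hA, one_smul]
    simp [cofSum, this, Finset.mul_sum]
  rw [h1, Matrix.det_add_replicateCol_mul_replicateRow hA, h2, Matrix.det_unique (n := Unit)]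
  simp only [Matrix.add_apply, Matrix.one_apply_eq, Matrix.mul_apply, Matrix.replicateRow_apply,
    Matrix.replicateCol_apply, one_mul, ← Finset.sum_mul]
  rw [Finset.sum_comm]
  ring

/-- The matrix determinant lemma for the rank-one matrix `x J`, over any commutative ring. -/
theorem det_add_smul_allOnes (A : Matrix n n R) (x : R) :
    (A + x • allOnes n R).det = A.det + x * cofSum A := by
  -- The identity is proved for a matrix of independent variables, invertible over the fraction
  -- field of `P`, and then specialized. The coefficient ring `Polynomial ℤ` provides one more
  -- variable to stand for `x`.
  let P := MvPolynomial (n × n) (Polynomial ℤ)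
  let U : Matrix n n P := Matrix.mvPolynomialX n n (Polynomial ℤ)
  let y : P := MvPolynomial.C Polynomial.X
  have hU : (U + y • allOnes n P).det = U.det + y * cofSum U := by
    let ψ := algebraMap P (FractionRing P)
    apply IsFractionRing.injective P (FractionRing P)
    have hdet : IsUnit (ψ.mapMatrix U).det := by
      rw [← RingHom.map_det, isUnit_iff_ne_zero]
      exact (map_ne_zero_iff ψ (IsFractionRing.injective P (FractionRing P))).2
        (Matrix.det_mvPolynomialX_ne_zero n _)
    have := det_add_smul_allOnes_of_isUnit hdet (ψ y)
    rw [cofSum_map, ← RingHom.map_det, ← map_mul, ← map_add] at this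
    rw [← this, RingHom.map_det]
    congr 1
    ext i j
    simp only [allOnes, RingHom.mapMatrix_apply, Matrix.map_apply, Matrix.add_apply,
      Matrix.smul_apply, Matrix.of_apply, smul_eq_mul, mul_one, map_add]
    rfl
  let g : P →+* R := MvPolynomial.eval₂Hom (Polynomial.eval₂RingHom (Int.castRingHom R) x)
    fun p => A p.1 p.2
  have hgU : g.mapMatrix U = A := by
    ext i j
    simp only [g, U, RingHom.mapMatrix_apply, Matrix.map_apply, Matrix.mvPolynomialX_apply]
    exact MvPolynomial.eval₂_X _ _ _
  have hgy : g y = x :=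
    (MvPolynomial.eval₂_C _ _ _).trans (Polynomial.eval₂_X _ _)
  have := congrArg g hU
  rw [map_add, map_mul, ← cofSum_map, RingHom.map_det, RingHom.map_det, hgU, hgy] at this
  rw [← this]
  congr 1
  rw [map_add, hgU]
  ext i j
  simp [hgy, allOnes]

theorem cofSum_eq_sub (A : Matrix n n R) :
    cofSum A = (A + (1 : R) • allOnes n R).det - (A + (0 : R) • allOnes n R).det := by
  rw [det_add_smul_allOnes, det_add_smul_allOnes]
  ring

/-- If `a A e = d e`, then `d eᵀ adj(A) e = a n det A`. -/
theorem mul_cofSum_of_mulVec {A : Matrix n n R} {a d : R}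
    (h : (a • A) *ᵥ (fun _ => (1 : R)) = d • (fun _ => (1 : R))) :
    d * cofSum A = a * Fintype.card n * A.det := by
  have h1 : A.adjugate *ᵥ ((a • A) *ᵥ (fun _ => (1 : R))) = fun _ => a * A.det := by
    rw [Matrix.mulVec_mulVec, Matrix.mul_smul, Matrix.adjugate_mul]
    ext i
    simp [Matrix.smul_mulVec]
  rw [h] at h1
  have h2 : d * cofSum A = ∑ i, (A.adjugate *ᵥ (d • (fun _ => (1 : R)))) i := by
    simp [cofSum, Matrix.mulVec, dotProduct, Finset.mul_sum, mul_comm]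
  rw [h2, h1]
  simp only [Finset.sum_const, Finset.card_univ, nsmul_eq_mul]
  ring

end Cofactors

/-! ### Invariants of a single block. -/

namespace BlockDatum

variable {R : Type*} [CommRing R] (B : BlockDatum R)

theorem kappa_eq_rho_add :
    B.kappa = B.rho + B.a ^ (B.size - 1) * cofSum (B.Dstar - allOnes _ R) := by
  have := det_add_smul_allOnes (B.Dstar - allOnes _ R) 1
  rw [one_smul, sub_add_cancel] at this
  rw [kappa, rho, this]
  ring

theorem a_mul_rho (h : 1 ≤ B.size) : B.a * B.rho = B.D.det := by
  rw [rho, D, Matrix.det_smul, Fintype.card_fin, ← mul_assoc, ← pow_succ', Nat.sub_add_cancel h]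

theorem det_D_add_smul_allOnes (h : 1 ≤ B.size) (x : R) :
    (B.D + x • allOnes _ R).det = x * B.kappa + (B.a - x) * B.rho := by
  rw [det_add_smul_allOnes, ← B.a_mul_rho h, kappa_eq_rho_add, D, cofSum_smul, Fintype.card_fin]
  ring

theorem d_mul_kappa {d : R} (h : B.D *ᵥ (fun _ => (1 : R)) = d • (fun _ => (1 : R))) :
    d * B.kappa = (d + B.a * B.size) * B.rho := by
  have := mul_cofSum_of_mulVec h
  rw [Fintype.card_fin] at this
  rw [kappa_eq_rho_add, mul_add, mul_left_comm, this, rho]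
  ring

/-- With `rho_of_size`, this makes one-node blocks neutral in all formulas, so the tree of blocks
may leave them out. -/
theorem kappa_of_size (h : B.size = 1) : B.kappa = 1 := by
  obtain ⟨p, a, M, hM⟩ := B
  obtain rfl : p = 1 := h
  simp [kappa, hM]

theorem rho_of_size (h : B.size = 1) : B.rho = 0 := by
  obtain ⟨p, a, M, hM⟩ := B
  obtain rfl : p = 1 := h
  simp [rho, hM, allOnes]

theorem D_diag (s : Fin B.size) : B.D s s = 0 := by simp [D, allOnes, B.diag]

theorem size_eq_one_of_subsingleton {V : Type*} (h : 1 ≤ B.size) {f : Fin B.size → V}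
    (hf : Function.Injective f) (hs : (Set.range f).Subsingleton) : B.size = 1 := by
  refine le_antisymm ?_ h
  by_contra! h2
  have := hf (hs ⟨⟨0, by omega⟩, rfl⟩ ⟨⟨1, h2⟩, rfl⟩)
  simp at this

end BlockDatum

/-! ### Tree-like unions of blocks -/

section BlockTree

variable {V ι : Type*} [DecidableEq ι]

/-- The set of nodes `S` is obtained from the blocks `blk e`, `e ∈ F`, by repeatedly gluing two
sets of nodes along a single node. -/
inductive BlockTree (blk : ι → Set V) : Set V → Finset ι → Prop
  | node (v : V) : BlockTree blk {v} ∅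
  | block (e : ι) : BlockTree blk (blk e) {e}
  | glue {A B : Set V} {F F' : Finset ι} (v : V) (hA : BlockTree blk A F)
      (hB : BlockTree blk B F') (hv : A ∩ B = {v}) (hF : Disjoint F F') :
      BlockTree blk (A ∪ B) (F ∪ F')

/-- The blocks `blk e`, `e ∈ F`, do not connect `i` and `j` outside of `v`. -/
def BlocksSeparate (blk : ι → Set V) (F : Finset ι) (v i j : V) : Prop :=
  ∃ C : Set V, i ∈ C ∧ v ∉ C ∧ j ∉ C ∧ j ≠ v ∧ ∀ e ∈ F, Disjoint C (blk e) ∨ blk e ⊆ insert v C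

variable {blk : ι → Set V} {S A B : Set V} {F F' : Finset ι}

theorem BlockTree.subset (h : BlockTree blk S F) : ∀ e ∈ F, blk e ⊆ S := by
  induction h with
  | node v => simp
  | block e => simp
  | glue v _ _ _ _ ihA ihB =>
    intro e he
    rcases Finset.mem_union.1 he with he | he
    · exact (ihA e he).trans Set.subset_union_left
    · exact (ihB e he).trans Set.subset_union_right

theorem BlockTree.inter_subsingleton (h : BlockTree blk S F) :
    ∀ e ∈ F, ∀ f ∈ F, e ≠ f → (blk e ∩ blk f).Subsingleton := by
  induction h with
  | node v => simp
  | block e => simp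
  | @glue A B F F' v hA hB hv _ ihA ihB =>
    have key : ∀ e ∈ F, ∀ f ∈ F', (blk e ∩ blk f).Subsingleton := fun e he f hf =>
      Set.subsingleton_singleton.anti
        (hv ▸ Set.inter_subset_inter (hA.subset e he) (hB.subset f hf))
    intro e he f hf hef
    rcases Finset.mem_union.1 he with he | he <;> rcases Finset.mem_union.1 hf with hf | hf
    · exact ihA e he f hf hef
    · exact key e he f hf
    · exact Set.inter_comm _ _ ▸ key f hf e he
    · exact ihB e he f hf hef

/-- The separating set is `A \ {v}`: blocks of `A` lie in it up to `v`, and blocks of `B` miss it.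
-/
theorem blocksSeparate_of_glue (hA : BlockTree blk A F) (hB : BlockTree blk B F') {v i j : V}
    (hv : A ∩ B = {v}) (hi : i ∈ A) (hiv : i ≠ v) (hj : j ∈ B) (hjv : j ≠ v) :
    BlocksSeparate blk (F ∪ F') v i j := by
  have hinter : ∀ x ∈ A, x ∈ B → x = v := fun x hx hx' => (hv ▸ ⟨hx, hx'⟩ : x ∈ ({v} : Set V))
  refine ⟨A \ {v}, ⟨hi, hiv⟩, fun h => h.2 rfl, fun h => hjv (hinter j h.1 hj), hjv, ?_⟩
  intro e he
  rcases Finset.mem_union.1 he with he | he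
  · refine Or.inr fun x hx => ?_
    by_cases hxv : x = v
    · exact Or.inl hxv
    · exact Or.inr ⟨hA.subset e he hx, hxv⟩
  · exact Or.inl (Set.disjoint_left.2 fun x hx hx' => hx.2 (hinter x hx.1 (hB.subset e he hx')))

/-- Since `B` hangs on `A` at the single node `u`, it goes entirely to the side of `u`: it is added
to `C` when `u ∈ C` and left out otherwise. This passes the distance rules of the whole graph down
to its parts. -/
theorem BlocksSeparate.union (hA : BlockTree blk A F) (hB : BlockTree blk B F') {u : V}
    (hu : A ∩ B = {u}) {v i j : V} (hv : v ∈ A) (hi : i ∈ A) (hj : j ∈ A)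
    (h : BlocksSeparate blk F v i j) : BlocksSeparate blk (F ∪ F') v i j := by
  have hinter : ∀ x ∈ A, x ∈ B → x = u := fun x hx hx' => (hu ▸ ⟨hx, hx'⟩ : x ∈ ({u} : Set V))
  obtain ⟨C, hiC, hvC, hjC, hjv, hC⟩ := h
  by_cases huC : u ∈ C
  · refine ⟨(C ∩ A) ∪ B, Or.inl ⟨hiC, hi⟩, ?_, ?_, hjv, ?_⟩
    · rintro (h | h)
      · exact hvC h.1
      · exact hvC (hinter v hv h ▸ huC)
    · rintro (h | h)
      · exact hjC h.1
      · exact hjC (hinter j hj h ▸ huC)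
    · intro e he
      rcases Finset.mem_union.1 he with he | he
      · refine (hC e he).imp (fun hd => ?_) fun hs x hx => ?_
        · rw [Set.disjoint_left] at hd ⊢
          rintro x (hx | hx) hx'
          · exact hd hx.1 hx'
          · exact hd huC (hinter x (hA.subset e he hx') hx ▸ hx')
        · exact (hs hx).imp id fun hxC => Or.inl ⟨hxC, hA.subset e he hx⟩
      · exact Or.inr fun x hx => Or.inr (Or.inr (hB.subset e he hx))
  · refine ⟨C ∩ A, ⟨hiC, hi⟩, fun h => hvC h.1, fun h => hjC h.1, hjv, ?_⟩
    intro e he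
    rcases Finset.mem_union.1 he with he | he
    · refine (hC e he).imp (fun hd => hd.mono_left Set.inter_subset_left) fun hs x hx => ?_
      exact (hs hx).imp id fun hxC => ⟨hxC, hA.subset e he hx⟩
    · refine Or.inl (Set.disjoint_left.2 fun x hx hx' => ?_)
      exact huC (hinter x hx.2 (hB.subset e he hx') ▸ hx.1)

/-! ### The invariants of a tree-like union of blocks -/

section Invariants

variable {R : Type*} [CommRing R] [Finite V] {𝒢 : ι → BlockDatum R}
  {φ : ∀ e, Fin (𝒢 e).size → V} {M D : Matrix V V R}

/-- Inside a block the reduced entry is `a (M i j - M i v * M v j)`, which is `a` times the Schur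
complement in `D*` of the diagonal entry `1` at `v`. Its determinant is therefore `a ^ (p - 1) det
D*`, whichever `v` is used. -/
theorem principalMinor_reduced_block (B : BlockDatum R) {f : Fin B.size → V}
    (hf : Function.Injective f) (hM : ∀ s t, M (f s) (f t) = B.Dstar s t)
    (hD : ∀ s t, D (f s) (f t) = B.D s t) {v : V} (hv : v ∈ Set.range f) :
    principalMinor (reduced M D v) (Set.range f \ {v}) = B.kappa := by
  classical
  have hvv : M v v = 1 := by
    obtain ⟨s, rfl⟩ := hv
    rw [hM, B.diag]
  let N : Matrix V V R := Matrix.of fun i j => if i = v then M v j else M i j - M i v * M v j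
  have h1 : principalMinor (reduced M D v) (Set.range f \ {v}) =
      principalMinor (B.a • N) (Set.range f \ {v}) := by
    refine principalMinor_congr ?_
    obtain ⟨r, rfl⟩ := hv
    rintro _ ⟨⟨s, rfl⟩, hs⟩ _ ⟨⟨t, rfl⟩, -⟩
    have : f s ≠ f r := hs
    simp [reduced, N, this, hM, hD, BlockDatum.D, allOnes]
    ring
  have hcard : (Set.range f \ {v}).ncard = B.size - 1 := by
    rw [Set.ncard_sdiff_singleton_of_mem hv, Set.ncard_range_of_injective hf, Nat.card_fin]
  have h2 : principalMinor M (Set.range f) = principalMinor N (Set.range f) := by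
    refine principalMinor_eq_of_row hv (fun i => if i = v then 0 else M i v) (by simp) ?_
    intro i _ j _
    by_cases hi : i = v <;> simp [N, hi]
  have h3 : principalMinor N (Set.range f) = principalMinor N (Set.range f \ {v}) := by
    have hS : Set.range f = {v} ∪ (Set.range f \ {v}) := by
      rw [Set.union_sdiff_self, Set.singleton_union, Set.insert_eq_of_mem hv]
    conv_lhs => rw [hS]
    rw [principalMinor_union, principalMinor_singleton]
    · simp [N, hvv]
    · simp
    · rintro i hi j rfl
      have : i ≠ j := hi.2
      simp [N, this, hvv]
  have h4 : principalMinor M (Set.range f) = B.Dstar.det := by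
    rw [principalMinor_range M hf]
    congr 1
    ext s t
    exact hM s t
  rw [h1, principalMinor_smul, hcard, ← h3, ← h2, h4, BlockDatum.kappa]

theorem principalMinor_add_block (B : BlockDatum R) (hB : 1 ≤ B.size) {f : Fin B.size → V}
    (hf : Function.Injective f) (hD : ∀ s t, D (f s) (f t) = B.D s t) (x : R) :
    principalMinor (D + x • allOnes V R) (Set.range f) = x * B.kappa + (B.a - x) * B.rho := by
  rw [principalMinor_range _ hf, ← B.det_D_add_smul_allOnes hB]
  congr 1
  ext s t
  simp [hD, allOnes]

theorem sum_mul_prod_erase_union {c κ : ι → R} (hF : Disjoint F F') :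
    ∑ e ∈ F ∪ F', c e * ∏ f ∈ (F ∪ F').erase e, κ f =
      (∑ e ∈ F, c e * ∏ f ∈ F.erase e, κ f) * ∏ f ∈ F', κ f +
      (∏ f ∈ F, κ f) * ∑ e ∈ F', c e * ∏ f ∈ F'.erase e, κ f := by
  rw [Finset.sum_union hF, Finset.sum_mul, Finset.mul_sum]
  congr 1
  · refine Finset.sum_congr rfl fun e he => ?_
    rw [Finset.erase_union_distrib, Finset.erase_eq_of_notMem (Finset.disjoint_left.1 hF he),
      Finset.prod_union (hF.mono_left (Finset.erase_subset _ _))]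
    ring
  · refine Finset.sum_congr rfl fun e he => ?_
    rw [Finset.erase_union_distrib, Finset.erase_eq_of_notMem (Finset.disjoint_right.1 hF he),
      Finset.prod_union (hF.mono_right (Finset.erase_subset _ _))]
    ring

theorem BlockTree.invariants (hsize : ∀ e, 1 ≤ (𝒢 e).size)
    (hφ : ∀ e, Function.Injective (φ e)) (hM1 : ∀ v, M v v = 1) (hD0 : ∀ v, D v v = 0)
    (hM : ∀ e s t, M (φ e s) (φ e t) = (𝒢 e).Dstar s t)
    (hD : ∀ e s t, D (φ e s) (φ e t) = (𝒢 e).D s t)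
    (h : BlockTree (fun e => Set.range (φ e)) S F) :
    (∀ v ∈ S, ∀ i ∈ S, ∀ j ∈ S, BlocksSeparate (fun e => Set.range (φ e)) F v i j →
      M i j = M i v * M v j ∧ D i j = D i v + M i v * D v j) →
    (∀ v ∈ S, principalMinor (reduced M D v) (S \ {v}) = ∏ e ∈ F, (𝒢 e).kappa) ∧
    ∀ x, principalMinor (D + x • allOnes V R) S = x * (∏ e ∈ F, (𝒢 e).kappa) +
      ∑ e ∈ F, (((𝒢 e).a - x) * (𝒢 e).rho) * ∏ f ∈ F.erase e, (𝒢 f).kappa := by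
  induction h with
  | node v =>
    intro _
    refine ⟨fun u hu => ?_, fun x => ?_⟩
    · obtain rfl : u = v := hu
      simp [principalMinor_empty]
    · simp [principalMinor_singleton, hD0, allOnes]
  | block e =>
    intro _
    refine ⟨fun v hv => ?_, fun x => ?_⟩
    · simpa using principalMinor_reduced_block (𝒢 e) (hφ e) (hM e) (hD e) hv
    · simpa using principalMinor_add_block (𝒢 e) (hsize e) (hφ e) (hD e) x
  | @glue A B F F' v hA hB hv hF ihA ihB =>
    intro hsep
    have hv' : B ∩ A = {v} := Set.inter_comm A B ▸ hv
    -- Separation requires `v` to differ from both ends; when it equals one of them, the rules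
    -- follow from the diagonal values `1` and `0`.
    have hrule : ∀ i ∈ A, ∀ j ∈ B, M i j = M i v * M v j ∧ D i j = D i v + M i v * D v j := by
      intro i hi j hj
      by_cases hiv : i = v
      · subst hiv; simp [hM1, hD0]
      by_cases hjv : j = v
      · subst hjv; simp [hM1, hD0]
      exact hsep v (Or.inl (hv ▸ rfl : v ∈ A ∩ B).1) i (Or.inl hi) j (Or.inr hj)
        (blocksSeparate_of_glue hA hB hv hi hiv hj hjv)
    have hrule' : ∀ i ∈ B, ∀ j ∈ A, M i j = M i v * M v j ∧ D i j = D i v + M i v * D v j := by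
      intro i hi j hj
      by_cases hiv : i = v
      · subst hiv; simp [hM1, hD0]
      by_cases hjv : j = v
      · subst hjv; simp [hM1, hD0]
      refine hsep v (Or.inl (hv ▸ rfl : v ∈ A ∩ B).1) i (Or.inr hi) j (Or.inl hj) ?_
      rw [Finset.union_comm]
      exact blocksSeparate_of_glue hB hA hv' hi hiv hj hjv
    have g : GluedAt M D v A B :=
      ⟨hv, fun i hi j hj => (hrule i hi j hj).1, fun i hi j hj => (hrule i hi j hj).2⟩
    have g' : GluedAt M D v B A :=
      ⟨hv', fun i hi j hj => (hrule' i hi j hj).1, fun i hi j hj => (hrule' i hi j hj).2⟩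
    obtain ⟨κA, dA⟩ := ihA fun u hu i hi j hj h =>
      hsep u (Or.inl hu) i (Or.inl hi) j (Or.inl hj) (h.union hA hB hv hu hi hj)
    obtain ⟨κB, dB⟩ := ihB fun u hu i hi j hj h =>
      hsep u (Or.inr hu) i (Or.inr hi) j (Or.inr hj)
        (Finset.union_comm F' F ▸ h.union hB hA hv' hu hi hj)
    refine ⟨fun u hu => ?_, fun x => ?_⟩
    · rw [Finset.prod_union hF]
      rcases hu with hu | hu
      · rw [g.principalMinor_reduced_left g' hu, κA u hu, κB v g.mem_right]
      · rw [Set.union_comm, g'.principalMinor_reduced_left g hu, κB u hu, κA v g.mem_left,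
          mul_comm]
    · rw [g.principalMinor_add_smul_allOnes g' (hD0 v), dA, dB, κA v g.mem_left,
        κB v g.mem_right, sum_mul_prod_erase_union hF, Finset.prod_union hF]
      ring

end Invariants

end BlockTree

/-! ### The distance matrices do not depend on the chosen cut-vertices -/

section Separators

variable {V : Type*} {G : SimpleGraph V}

/-- A path visits each node once, so its two halves share only the node where they meet. -/
theorem eq_of_mem_support_append {i v j x : V} {p : G.Walk i v} {q : G.Walk v j}
    (h : (p.append q).IsPath) (hp : x ∈ p.support) (hq : x ∈ q.support) : x = v := by
  have hn := h.support_nodup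
  rw [SimpleGraph.Walk.support_append, List.nodup_append] at hn
  rw [← q.cons_tail_support, List.mem_cons] at hq
  exact hq.resolve_right fun hq => hn.2.2 x hp x hq rfl

/-- Two cut-vertices between `i` and `j` are passed in a fixed order. -/
theorem Separates.order {v c i j : V} (hv : Separates G v i j) (hc : Separates G c i j)
    (hvc : v ≠ c) :
    (Separates G c i v ∧ Separates G v c j) ∨ (Separates G v i c ∧ Separates G c v j) := by
  classical
  obtain ⟨hvi, hvj, ⟨w⟩, hvw⟩ := hv
  obtain ⟨hci, hcj, -, hcw⟩ := hc
  have hp : w.bypass.IsPath := w.bypass_isPath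
  set p := w.bypass
  have hvp := hvw p
  set q₁ := p.takeUntil v hvp
  set q₂ := p.dropUntil v hvp
  have hq : (q₁.append q₂).IsPath := by rwa [SimpleGraph.Walk.take_spec]
  -- One path fixes the order of `v` and `c`. Any other walk between two of the four nodes is
  -- completed by a piece of this path to a walk from `i` to `j`; the separator under consideration
  -- lies on the whole walk but not on the added piece, hence on the given walk.
  by_cases h : c ∈ q₁.support
  · have hr : ((q₁.takeUntil c h).append (q₁.dropUntil c h)).IsPath := by
      rw [SimpleGraph.Walk.take_spec]; exact hq.of_append_left
    refine Or.inl ⟨⟨hci, hvc.symm, ⟨q₁⟩, fun u => ?_⟩, ⟨hvc, hvj, ⟨(q₁.dropUntil c h).append q₂⟩,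
      fun u => ?_⟩⟩
    · have := hcw (u.append q₂)
      rw [SimpleGraph.Walk.mem_support_append_iff] at this
      exact this.resolve_right fun h' => hvc (eq_of_mem_support_append hq h h').symm
    · have := hvw ((q₁.takeUntil c h).append u)
      rw [SimpleGraph.Walk.mem_support_append_iff] at this
      exact this.resolve_left fun h' =>
        hvc (eq_of_mem_support_append hr h' (SimpleGraph.Walk.end_mem_support _))
  · have hc₂ : c ∈ q₂.support := by
      have := hcw (q₁.append q₂)
      rw [SimpleGraph.Walk.mem_support_append_iff] at this
      exact this.resolve_left h
    have hr : ((q₂.takeUntil c hc₂).append (q₂.dropUntil c hc₂)).IsPath := by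
      rw [SimpleGraph.Walk.take_spec]; exact hq.of_append_right
    refine Or.inr ⟨⟨hvi, hvc, ⟨q₁.append (q₂.takeUntil c hc₂)⟩, fun u => ?_⟩,
      ⟨hvc.symm, hcj, ⟨q₂⟩, fun u => ?_⟩⟩
    · have := hvw (u.append (q₂.dropUntil c hc₂))
      rw [SimpleGraph.Walk.mem_support_append_iff] at this
      exact this.resolve_right fun h' =>
        hvc (eq_of_mem_support_append hr (SimpleGraph.Walk.start_mem_support _) h')
    · have := hcw (q₁.append u)
      rw [SimpleGraph.Walk.mem_support_append_iff] at this
      exact this.resolve_left h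

theorem Separates.ne {v i j : V} (h : Separates G v i j) : i ≠ j := by
  rintro rfl
  have := h.2.2.2 SimpleGraph.Walk.nil
  rw [SimpleGraph.Walk.support_nil, List.mem_singleton] at this
  exact h.1 this

end Separators

/-! ### The distance rules at every cut-vertex, and the entries inside a block. -/

section DistanceRules

variable {V ι R : Type*} [CommRing R] {G : SimpleGraph V} {𝒢 : ι → BlockDatum R}
  {φ : ∀ e, Fin (𝒢 e).size → V}

theorem multDist_self (v : V) : multDist G 𝒢 φ v v = 1 := by
  rw [multDist, if_pos rfl]

theorem addMultDist_self (v : V) : addMultDist G 𝒢 φ v v = 0 := by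
  rw [addMultDist, if_pos rfl]

/-- The rules for the distances hold at every cut-vertex. -/
theorem distance_rules
    (hφ : ∀ v i j, Separates G v i j → ¬ ∃ x, IsLabel φ i j x) (v i j : V)
    (h : Separates G v i j) :
    multDist G 𝒢 φ i j = multDist G 𝒢 φ i v * multDist G 𝒢 φ v j ∧
    addMultDist G 𝒢 φ i j = addMultDist G 𝒢 φ i v + multDist G 𝒢 φ i v * addMultDist G 𝒢 φ v j := by
  induction hn : G.dist i j using Nat.strong_induction_on generalizing v i j with
  | _ n ih =>
  subst hn
  have hex : ∃ v, Separates G v i j := ⟨v, h⟩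
  obtain ⟨c, hc, hm, hd⟩ : ∃ c, Separates G c i j ∧
      multDist G 𝒢 φ i j = multDist G 𝒢 φ i c * multDist G 𝒢 φ c j ∧
      addMultDist G 𝒢 φ i j =
        addMultDist G 𝒢 φ i c + multDist G 𝒢 φ i c * addMultDist G 𝒢 φ c j := by
    refine ⟨hex.choose, hex.choose_spec, ?_, ?_⟩
    · rw [multDist, if_neg h.ne, dif_neg (hφ v i j h), dif_pos hex]
    · rw [addMultDist, if_neg h.ne, dif_neg (hφ v i j h), dif_pos hex]
  by_cases hvc : v = c
  · subst hvc; exact ⟨hm, hd⟩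
  -- By induction on the distance, the splitting at `v` and the one at the chosen `c` refine to the
  -- same three-part splitting through both nodes.
  rcases h.order hc hvc with ⟨h1, h2⟩ | ⟨h1, h2⟩
  · obtain ⟨m1, d1⟩ := ih _ h.dist_lt.1 c i v h1 rfl
    obtain ⟨m2, d2⟩ := ih _ hc.dist_lt.2 v c j h2 rfl
    rw [hm, hd, m1, d1, m2, d2]
    constructor <;> ring
  · obtain ⟨m1, d1⟩ := ih _ hc.dist_lt.1 v i c h1 rfl
    obtain ⟨m2, d2⟩ := ih _ h.dist_lt.2 c v j h2 rfl
    rw [hm, hd, m1, d1, m2, d2]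
    constructor <;> ring

/-- The entries of the distance matrices inside a block. -/
theorem distance_labels (hφ : ∀ e, Function.Injective (φ e))
    (hφ' : ∀ e f, e ≠ f → (Set.range (φ e) ∩ Set.range (φ f)).Subsingleton)
    (e : ι) (s t : Fin (𝒢 e).size) :
    multDist G 𝒢 φ (φ e s) (φ e t) = (𝒢 e).Dstar s t ∧
    addMultDist G 𝒢 φ (φ e s) (φ e t) = (𝒢 e).D s t := by
  by_cases hst : s = t
  · subst hst
    rw [multDist_self, addMultDist_self, (𝒢 e).diag, (𝒢 e).D_diag]
    exact ⟨rfl, rfl⟩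
  have hne : φ e s ≠ φ e t := fun h => hst (hφ e h)
  have hex : ∃ x, IsLabel φ (φ e s) (φ e t) x := ⟨⟨e, s, t⟩, rfl, rfl⟩
  -- Distinct blocks share at most one node, so two different nodes determine their label and the
  -- choice in the definition is harmless.
  have huniq : ∀ x, IsLabel φ (φ e s) (φ e t) x → x = ⟨e, s, t⟩ := by
    rintro ⟨f, s', t'⟩ ⟨h1, h2⟩
    obtain rfl : f = e := by
      by_contra hfe
      exact hne (hφ' f e hfe ⟨⟨s', h1⟩, ⟨s, rfl⟩⟩ ⟨⟨t', h2⟩, ⟨t, rfl⟩⟩)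
    obtain rfl := hφ f h1
    obtain rfl := hφ f h2
    rfl
  rw [multDist, addMultDist, if_neg hne, dif_pos hex, if_neg hne, dif_pos hex,
    huniq _ hex.choose_spec]
  exact ⟨rfl, rfl⟩

end DistanceRules

/-! ### The strong blocks of a connected graph form a tree -/

section StrongBlocks

variable {W : Type*} {G : SimpleGraph W} {S C : Set W} {v : W}

/-- `S` induces a preconnected subgraph, in terms of sets without outgoing edges. -/
def SetPreconnected (G : SimpleGraph W) (S : Set W) : Prop :=
  ∀ T ⊆ S, T.Nonempty → (∀ x ∈ T, ∀ y ∈ S, G.Adj x y → y ∈ T) → S ⊆ T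

theorem preconnected_iff_setPreconnected_range {U : Type*} {H : SimpleGraph U} (f : H ↪g G) :
    H.Preconnected ↔ SetPreconnected G (Set.range f) := by
  constructor
  · rintro h T hT ⟨x, hx⟩ hcl _ ⟨b, rfl⟩
    obtain ⟨a, rfl⟩ := hT hx
    obtain ⟨w⟩ := h a b
    induction w with
    | nil => exact hx
    | cons hadj _ ih => exact ih (hcl _ hx _ ⟨_, rfl⟩ (f.map_adj_iff.2 hadj))
  · intro h a b
    have := h (f '' {c | H.Reachable a c}) (Set.image_subset_range _ _) ⟨f a, a, .rfl, rfl⟩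
      (by
        rintro _ ⟨c, hc, rfl⟩ _ ⟨d, rfl⟩ hadj
        exact ⟨d, SimpleGraph.Reachable.trans hc (f.map_adj_iff.1 hadj).reachable, rfl⟩)
    obtain ⟨c, hc, hcb⟩ := this ⟨b, rfl⟩
    exact f.injective hcb ▸ hc

theorem preconnected_induce_iff :
    (G.induce S).Preconnected ↔ SetPreconnected G S := by
  rw [preconnected_iff_setPreconnected_range (SimpleGraph.Embedding.induce S)]
  congr!
  exact Subtype.range_coe

theorem noCutVertex_induce_iff :
    NoCutVertex (G.induce S) ↔ ∀ v ∈ S, SetPreconnected G (S \ {v}) := by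
  have key : ∀ v : S, ((G.induce S).induce ({v}ᶜ : Set S)).Preconnected ↔
      SetPreconnected G (S \ {v.1}) := by
    intro v
    rw [preconnected_iff_setPreconnected_range
      ((SimpleGraph.Embedding.induce (G := G) S).comp (SimpleGraph.Embedding.induce _))]
    congr!
    ext x
    constructor
    · rintro ⟨y, rfl⟩
      exact ⟨y.1.2, fun h => y.2 (Subtype.ext h)⟩
    · rintro ⟨hx, hxv⟩
      exact ⟨⟨⟨x, hx⟩, fun h => hxv (congrArg Subtype.val h)⟩, rfl⟩
  exact ⟨fun h v hv => (key ⟨v, hv⟩).1 (h ⟨v, hv⟩), fun h v => (key v).2 (h v v.2)⟩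

theorem connected_noCutVertex_iff :
    ((G.induce S).Connected ∧ NoCutVertex (G.induce S)) ↔
      S.Nonempty ∧ SetPreconnected G S ∧ ∀ v ∈ S, SetPreconnected G (S \ {v}) := by
  rw [noCutVertex_induce_iff, SimpleGraph.connected_iff, preconnected_induce_iff,
    Set.nonempty_coe_sort, and_assoc, and_left_comm]

theorem IsStrongBlock.setPreconnected_sdiff (h : IsStrongBlock G S) (v : W) :
    SetPreconnected G (S \ {v}) := by
  obtain ⟨-, h1, h2⟩ := connected_noCutVertex_iff.1 h.prop
  by_cases hv : v ∈ S
  · exact h2 v hv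
  · rwa [Set.sdiff_singleton_eq_self hv]

theorem exists_isStrongBlock [Finite W] (h0 : S.Nonempty) (h1 : SetPreconnected G S)
    (h2 : ∀ v ∈ S, SetPreconnected G (S \ {v})) : ∃ B, IsStrongBlock G B ∧ S ⊆ B := by
  obtain ⟨B, hSB, hB⟩ := Finite.exists_le_maximal
    (p := fun S : Set W => (G.induce S).Connected ∧ NoCutVertex (G.induce S))
    (connected_noCutVertex_iff.2 ⟨h0, h1, h2⟩)
  exact ⟨B, hB, hSB⟩

theorem setPreconnected_of_subsingleton (h : S.Subsingleton) : SetPreconnected G S := by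
  rintro T hT ⟨x, hx⟩ - y hy
  exact h (hT hx) hy ▸ hx

theorem exists_isStrongBlock_of_adj [Finite W] {s t : W} (h : G.Adj s t) :
    ∃ B, IsStrongBlock G B ∧ s ∈ B ∧ t ∈ B := by
  have h1 : SetPreconnected G {s, t} := by
    rintro T hT ⟨x, hx⟩ hcl
    have hst : s ∈ T ∧ t ∈ T := by
      rcases hT hx with rfl | rfl
      · exact ⟨hx, hcl _ hx _ (Or.inr rfl) h⟩
      · exact ⟨hcl _ hx _ (Or.inl rfl) h.symm, hx⟩
    rintro y (rfl | rfl)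
    exacts [hst.1, hst.2]
  have h2 : ∀ v ∈ ({s, t} : Set W), SetPreconnected G ({s, t} \ {v}) := by
    intro v hv
    refine setPreconnected_of_subsingleton ?_
    rintro x ⟨hx, hxv⟩ y ⟨hy, hyv⟩
    simp only [Set.mem_insert_iff, Set.mem_singleton_iff] at hv hx hy hxv hyv
    grind
  obtain ⟨B, hB, hS⟩ := exists_isStrongBlock ⟨s, Or.inl rfl⟩ h1 h2
  exact ⟨B, hB, hS (Or.inl rfl), hS (Or.inr rfl)⟩

/-- `C` has no edges to the rest of `S \ {v}`. -/
structure IsBranch (G : SimpleGraph W) (S : Set W) (v : W) (C : Set W) : Prop where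
  subset : C ⊆ S \ {v}
  closed : ∀ x ∈ C, ∀ y ∈ S \ {v}, G.Adj x y → y ∈ C

theorem IsBranch.compl (h : IsBranch G S v C) : IsBranch G S v ((S \ {v}) \ C) where
  subset := Set.sdiff_subset
  closed x hx y hy hadj := ⟨hy, fun hyC => hx.2 (h.closed y hyC x hx.1 hadj.symm)⟩

/-- A closed part `T` of `C ∪ {v}` containing `v` stays closed in `S` after adding everything
outside the branch, because `v` is the only exit. One that misses `v` is already closed in `S`,
contradicting connectedness of `S`. -/
theorem IsBranch.setPreconnected (h : IsBranch G S v C) (hv : v ∈ S)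
    (hS : SetPreconnected G S) : SetPreconnected G (insert v C) := by
  have hsub : insert v C ⊆ S := Set.insert_subset hv (h.subset.trans Set.sdiff_subset)
  intro T hT hne hcl
  by_cases hvT : v ∈ T
  · have := hS (T ∪ (S \ insert v C)) (Set.union_subset (hT.trans hsub) Set.sdiff_subset)
      (hne.mono Set.subset_union_left) (by
        rintro x (hx | hx) y hy hadj
        · by_cases hyC : y ∈ insert v C
          · exact Or.inl (hcl x hx y hyC hadj)
          · exact Or.inr ⟨hy, hyC⟩
        · by_cases hyC : y ∈ insert v C
          · rcases hyC with rfl | hyC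
            · exact Or.inl hvT
            · exact absurd (Or.inr (h.closed y hyC x ⟨hx.1, fun e => hx.2 (Or.inl e)⟩ hadj.symm))
                hx.2
          · exact Or.inr ⟨hy, hyC⟩)
    exact fun x hx => (this (hsub hx)).resolve_right fun h => h.2 hx
  · refine absurd (hS T (hT.trans hsub) hne ?_ hv) hvT
    intro x hx y hy hadj
    have hxC : x ∈ C := (hT hx).resolve_left fun e => hvT (e ▸ hx)
    by_cases hyv : y = v
    · exact hcl x hx y (Or.inl hyv) hadj
    · exact hcl x hx y (Or.inr (h.closed x hxC y ⟨hy, hyv⟩ hadj)) hadj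

/-- Removing `v` leaves `P` connected, so once it meets the branch it cannot leave it. -/
theorem IsBranch.strongBlock_subset (h : IsBranch G S v C) {P : Set W} (hP : IsStrongBlock G P)
    (hPS : P ⊆ S) (hPC : (P ∩ C).Nonempty) : P ⊆ insert v C := by
  have := hP.setPreconnected_sdiff v (P ∩ C)
    (fun x hx => ⟨hx.1, (h.subset hx.2).2⟩) hPC
    (fun x hx y hy hadj => ⟨hy.1, h.closed x hx.2 y ⟨hPS hy.1, hy.2⟩ hadj⟩)
  intro x hx
  by_cases hxv : x = v
  · exact Or.inl hxv
  · exact Or.inr (this ⟨hx, hxv⟩).2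

theorem IsBranch.strongBlock_subset_of_nontrivial (h : IsBranch G S v C) (hv : v ∈ S)
    {P : Set W} (hP : IsStrongBlock G P) (hPS : (P ∩ S).Nontrivial → P ⊆ S)
    (hPC : (P ∩ insert v C).Nontrivial) : P ⊆ insert v C := by
  have hsub : insert v C ⊆ S := Set.insert_subset hv (h.subset.trans Set.sdiff_subset)
  obtain ⟨x, hx, hxv⟩ := hPC.exists_ne v
  exact h.strongBlock_subset hP (hPS (hPC.mono (Set.inter_subset_inter_right _ hsub)))
    ⟨x, hx.1, hx.2.resolve_left hxv⟩

open Classical in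
/-- The part `S` of a graph is a tree-like union of the strong blocks with at least two nodes
which are contained in it. -/
theorem blockTree_of_setPreconnected [Finite W] {V ι J : Type*} [DecidableEq ι] [Fintype J]
    {b : J → Set W} (hb : ∀ j, IsStrongBlock G (b j)) (hinj : Function.Injective b)
    (hsurj : ∀ B, IsStrongBlock G B → ∃ j, b j = B) (base : W ↪ V) (g : J ↪ ι)
    {blk : ι → Set V} (hblk : ∀ j, blk (g j) = base '' b j) (S : Set W) (hne : S.Nonempty)
    (hS : SetPreconnected G S) (hcl : ∀ j, (b j ∩ S).Nontrivial → b j ⊆ S) :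
    BlockTree blk (base '' S)
      ((Finset.univ.filter fun j => b j ⊆ S ∧ (b j).Nontrivial).map g) := by
  induction hn : S.ncard using Nat.strong_induction_on generalizing S with
  | _ n ih =>
  subst hn
  by_cases hnt : S.Nontrivial
  swap
  -- A single node is a tree with no blocks, as only blocks with at least two nodes are recorded.
  · obtain ⟨v, rfl⟩ := (Set.not_nontrivial_iff.1 hnt).eq_empty_or_singleton.resolve_left hne.ne_empty
    rw [Finset.filter_false_of_mem, Set.image_singleton]
    · exact BlockTree.node _
    · rintro j - ⟨h1, h2⟩
      exact hnt (h2.mono h1)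
  by_cases hcut : ∀ v ∈ S, SetPreconnected G (S \ {v})
  · obtain ⟨B, hB, hSB⟩ := exists_isStrongBlock hne hS hcut
    obtain ⟨j, rfl⟩ := hsurj B hB
    -- A part without cut-vertices lies in some strong block; `hcl` forces that block back into `S`,
    -- so the two agree.
    obtain rfl : S = b j :=
      hSB.antisymm (hcl j (by rwa [Set.inter_eq_self_of_subset_right hSB]))
    have : (Finset.univ.filter fun i => b i ⊆ b j ∧ (b i).Nontrivial) = {j} := by
      ext i
      simp only [Finset.mem_filter, Finset.mem_univ, true_and, Finset.mem_singleton]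
      refine ⟨fun h => hinj ((hb i).eq_of_le (hb j).prop h.1), ?_⟩
      rintro rfl
      exact ⟨subset_rfl, hnt⟩
    rw [this, Finset.map_singleton, ← hblk]
    exact BlockTree.block _
  · push Not at hcut
    obtain ⟨v, hv, hcut⟩ := hcut
    unfold SetPreconnected at hcut
    push Not at hcut
    obtain ⟨T, hT, hTne, hTcl, hTS⟩ := hcut
    have hbr : IsBranch G S v T := ⟨hT, hTcl⟩
    have hbr' := hbr.compl
    set T' := (S \ {v}) \ T
    obtain ⟨y, hyS, hyT⟩ := Set.not_subset.1 hTS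
    have hT'ne : T'.Nonempty := ⟨y, hyS, hyT⟩
    have hcard : ∀ C C' : Set W, IsBranch G S v C → IsBranch G S v C' → C'.Nonempty →
        Disjoint C C' → (insert v C).ncard < S.ncard := by
      rintro C C' hC hC' ⟨z, hz⟩ hd
      refine Set.ncard_lt_ncard ⟨Set.insert_subset hv (hC.subset.trans Set.sdiff_subset), ?_⟩
      intro hle
      rcases hle (hC'.subset hz).1 with e | hzC
      · exact (hC'.subset hz).2 e
      · exact Set.disjoint_left.1 hd hzC hz
    have hdis : Disjoint T T' := Set.disjoint_sdiff_right
    have hU : insert v T ∪ insert v T' = S := by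
      ext x
      by_cases hxv : x = v
      · subst hxv; simpa using hv
      · by_cases hxT : x ∈ T
        · simpa [hxv, hxT] using (hT hxT).1
        · simp [hxv, hxT, T']
    have hI : insert v T ∩ insert v T' = {v} := by
      rw [← Set.insert_inter_distrib, Set.disjoint_iff_inter_eq_empty.1 hdis]
      simp
    have tA := ih _ (hcard T T' hbr hbr' hT'ne hdis) (insert v T) ⟨v, Or.inl rfl⟩
      (hbr.setPreconnected hv hS)
      (fun j => hbr.strongBlock_subset_of_nontrivial hv (hb j) (hcl j)) rfl
    have tB := ih _ (hcard T' T hbr' hbr hTne hdis.symm) (insert v T') ⟨v, Or.inl rfl⟩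
      (hbr'.setPreconnected hv hS)
      (fun j => hbr'.strongBlock_subset_of_nontrivial hv (hb j) (hcl j)) rfl
    -- The two sets of blocks are disjoint because a common block would lie in `{v}`, whereas
    -- recorded blocks are nontrivial.
    have := BlockTree.glue (base v) tA tB
      (by rw [← Set.image_inter base.injective, hI, Set.image_singleton]) (by
        rw [Finset.disjoint_map, Finset.disjoint_left]
        intro j hj hj'
        simp only [Finset.mem_filter, Finset.mem_univ, true_and] at hj hj'
        have := hI ▸ Set.subset_inter hj.1 hj'.1
        exact Set.not_nontrivial_singleton (hj.2.mono this))
    rw [← Set.image_union, hU, ← Finset.map_union] at this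
    convert! this using 2
    ext j
    simp only [Finset.mem_filter, Finset.mem_univ, true_and, Finset.mem_union]
    constructor
    · rintro ⟨hj, hjn⟩
      obtain ⟨x, hx, hxv⟩ := hjn.exists_ne v
      by_cases hxT : x ∈ T
      · exact Or.inl ⟨hbr.strongBlock_subset (hb j) hj ⟨x, hx, hxT⟩, hjn⟩
      · exact Or.inr ⟨hbr'.strongBlock_subset (hb j) hj ⟨x, hx, ⟨hj hx, hxv⟩, hxT⟩, hjn⟩
    · rintro (⟨hj, hjn⟩ | ⟨hj, hjn⟩)
      · exact ⟨hU ▸ hj.trans Set.subset_union_left, hjn⟩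
      · exact ⟨hU ▸ hj.trans Set.subset_union_right, hjn⟩

end StrongBlocks

universe u w

/-! ### The graph with the attached cliques -/

theorem BlockTree.reachable {V ι : Type*} [DecidableEq ι] {blk : ι → Set V} {G : SimpleGraph V}
    (hblk : ∀ e, ∀ x ∈ blk e, ∀ y ∈ blk e, G.Reachable x y) {S : Set V} {F : Finset ι}
    (h : BlockTree blk S F) : ∀ x ∈ S, ∀ y ∈ S, G.Reachable x y := by
  induction h with
  | node v => rintro x rfl y rfl; exact .rfl
  | block e => exact hblk e
  | @glue A B F F' v _ _ hv _ ihA ihB =>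
    have hv' : v ∈ A ∩ B := hv ▸ rfl
    have key : ∀ x ∈ A ∪ B, G.Reachable x v := fun x hx =>
      hx.elim (fun h => ihA x h v hv'.1) fun h => ihB x h v hv'.2
    exact fun x hx y hy => (key x hx).trans (key y hy).symm

/-- Every walk from `i` to `j` leaves `C` along some edge. The block of this edge meets `C`, hence
lies in `C ∪ {v}`, so the edge ends at `v`. -/
theorem BlocksSeparate.separates {V ι : Type*} {blk : ι → Set V} {G : SimpleGraph V}
    (hG : ∀ x y, G.Reachable x y) {F : Finset ι}
    (hadj : ∀ x y, G.Adj x y → ∃ e ∈ F, x ∈ blk e ∧ y ∈ blk e) {v i j : V}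
    (h : BlocksSeparate blk F v i j) : Separates G v i j := by
  obtain ⟨C, hi, hv, hj, hjv, hC⟩ := h
  refine ⟨fun e => hv (e ▸ hi), hjv.symm, hG i j, fun w => ?_⟩
  obtain ⟨d, hd, hd1, hd2⟩ := w.exists_boundary_dart C hi hj
  obtain ⟨e, he, he1, he2⟩ := hadj _ _ d.adj
  rcases hC e he with h | h
  · exact absurd he1 (Set.disjoint_left.1 h hd1)
  · exact (h he2).resolve_right hd2 ▸ w.dart_snd_mem_support_of_mem_darts hd

/-- In a block without cut-vertices, two nodes are joined by a walk avoiding a third node. -/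
theorem exists_walk_avoiding {U V : Type*} {H : SimpleGraph U} {G : SimpleGraph V}
    (h1 : H.Connected) (h2 : NoCutVertex H) {f : H →g G} (hf : Function.Injective f) {v : V}
    {s t : U} (hs : f s ≠ v) (ht : f t ≠ v) : ∃ w : G.Walk (f s) (f t), v ∉ w.support := by
  -- If `v` is a node of the block, this is the absence of cut-vertices; otherwise nothing is
  -- removed and the block is connected anyway.
  have hpre : (H.induce {s | f s ≠ v}).Preconnected := by
    by_cases hv : ∃ s₀, f s₀ = v
    · obtain ⟨s₀, rfl⟩ := hv
      have : {s | f s ≠ f s₀} = ({s₀}ᶜ : Set U) := by ext x; simp [hf.eq_iff]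
      rw [this]
      exact h2 s₀
    · push Not at hv
      have : {s | f s ≠ v} = Set.range (SimpleGraph.Embedding.refl : H ↪g H) := by
        ext x; simpa using hv x
      rw [preconnected_induce_iff, this, ← preconnected_iff_setPreconnected_range]
      exact h1.preconnected
  obtain ⟨w⟩ := hpre ⟨s, hs⟩ ⟨t, ht⟩
  let g : H.induce {s | f s ≠ v} →g G := f.comp (SimpleGraph.Embedding.induce _).toHom
  refine ⟨w.map g, fun hv => ?_⟩
  obtain ⟨x, -, hx⟩ := List.mem_map.1 (SimpleGraph.Walk.support_map g w ▸ hv)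
  exact x.2 hx

namespace CliqueExtension

variable {R : Type*} [CommRing R] {k : ℕ} {𝓑 : Fin k → BlockDatum R} {E : Type w} [Fintype E]
  {𝓒 : E → CliqueDatum R}
  (X : CliqueExtension.{u, w} (fun j => (𝓑 j).size) (fun e => (𝓒 e).size))

/-- The blocks of `G₀`, mapped to the graph with the attached cliques. -/
def blockHom (j : Fin k) : X.H j →g X.G where
  toFun s := X.base (X.emb j s)
  map_rel' h := (X.adj_iff _ _).2 (Or.inl ⟨_, _, (X.emb j).map_adj_iff.2 h, rfl, rfl⟩)

theorem blockHom_injective (j : Fin k) : Function.Injective (X.blockHom j) :=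
  X.base.injective.comp (X.emb j).injective

theorem labels_injective : ∀ i, Function.Injective (X.labels i)
  | .inl j => X.blockHom_injective j
  | .inr e => (X.clique e).injective

theorem finite_V₀ : Finite X.V₀ := Finite.of_injective X.base X.base.injective

theorem adj_exists_labels {x y : X.V} (h : X.G.Adj x y) :
    ∃ i, x ∈ Set.range (X.labels i) ∧ y ∈ Set.range (X.labels i) := by
  have := X.finite_V₀
  rcases (X.adj_iff x y).1 h with ⟨s, t, hst, rfl, rfl⟩ | ⟨-, e, hx, hy⟩
  · obtain ⟨B, hB, hs, ht⟩ := exists_isStrongBlock_of_adj hst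
    obtain ⟨j, rfl⟩ := X.emb_surjective B hB
    obtain ⟨s, rfl⟩ := hs
    obtain ⟨t, rfl⟩ := ht
    exact ⟨.inl j, ⟨s, rfl⟩, ⟨t, rfl⟩⟩
  · exact ⟨.inr e, hx, hy⟩

theorem exists_walk_avoiding_of_labels {v x y : X.V} (i : Fin k ⊕ E)
    (hx : x ∈ Set.range (X.labels i)) (hy : y ∈ Set.range (X.labels i)) (hvx : v ≠ x)
    (hvy : v ≠ y) : ∃ w : X.G.Walk x y, v ∉ w.support := by
  rcases i with j | e
  · obtain ⟨s, rfl⟩ := hx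
    obtain ⟨t, rfl⟩ := hy
    exact exists_walk_avoiding (X.H_connected j) (X.H_noCutVertex j) (X.blockHom_injective j)
      hvx.symm hvy.symm
  · by_cases hxy : x = y
    · subst hxy
      exact ⟨.nil, by simpa using hvx⟩
    · have hadj : X.G.Adj x y := (X.adj_iff x y).2 (Or.inr ⟨hxy, e, hx, hy⟩)
      exact ⟨hadj.toWalk, by simp [hvx, hvy]⟩

theorem reachable_of_labels {x y : X.V} (i : Fin k ⊕ E)
    (hx : x ∈ Set.range (X.labels i)) (hy : y ∈ Set.range (X.labels i)) : X.G.Reachable x y := by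
  rcases i with j | e
  · obtain ⟨s, rfl⟩ := hx
    obtain ⟨t, rfl⟩ := hy
    exact ((X.H_connected j).preconnected s t).map (X.blockHom j)
  · by_cases hxy : x = y
    · exact hxy ▸ .rfl
    · exact SimpleGraph.Adj.reachable ((X.adj_iff x y).2 (Or.inr ⟨hxy, e, hx, hy⟩))

theorem not_isLabel_of_separates {v x y : X.V} (h : Separates X.G v x y) :
    ¬ ∃ l, IsLabel X.labels x y l := by
  rintro ⟨⟨i, s, t⟩, hs, ht⟩
  obtain ⟨w, hw⟩ := X.exists_walk_avoiding_of_labels i ⟨s, hs⟩ ⟨t, ht⟩ h.1 h.2.1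
  exact hw (h.2.2.2 w)

/-- The nodes of the graph after the first `n` cliques have been attached. -/
def stage (n : ℕ) : Set X.V :=
  Set.range X.base ∪ ⋃ f, ⋃ _ : (X.order f : ℕ) < n, Set.range (X.clique f)

theorem stage_zero : X.stage 0 = Set.range X.base := by simp [stage]

theorem stage_succ (e : E) :
    X.stage (X.order e + 1) = X.stage (X.order e) ∪ Set.range (X.clique e) := by
  ext x
  simp only [stage, Set.mem_union, Set.mem_iUnion, exists_prop, or_assoc]
  refine or_congr_right ⟨?_, ?_⟩
  · rintro ⟨f, hf, hx⟩
    rcases Nat.lt_succ_iff_lt_or_eq.1 hf with hf | hf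
    · exact Or.inl ⟨f, hf, hx⟩
    · exact Or.inr (X.order.injective (Fin.ext hf) ▸ hx)
  · rintro (⟨f, hf, hx⟩ | hx)
    · exact ⟨f, hf.trans (Nat.lt_succ_self _), hx⟩
    · exact ⟨e, Nat.lt_succ_self _, hx⟩

theorem stage_card : X.stage (Fintype.card E) = Set.univ := by
  rw [← X.cover]
  simp [stage]

variable [DecidableEq E]

/-- All blocks with at least two nodes form a tree. -/
theorem exists_blockTree : ∃ F : Finset (Fin k ⊕ E),
    BlockTree (fun i => Set.range (X.labels i)) Set.univ F ∧
      ∀ i ∉ F, (Set.range (X.labels i)).Subsingleton := by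
  classical
  have := X.finite_V₀
  let F₀ : Finset (Fin k) := Finset.univ.filter fun j =>
    Set.range (X.emb j) ⊆ Set.univ ∧ (Set.range (X.emb j)).Nontrivial
  have h0 : BlockTree (fun i => Set.range (X.labels i)) (Set.range X.base)
      (F₀.map Function.Embedding.inl) := by
    have hne := X.G₀_connected.nonempty
    rw [← Set.image_univ]
    refine blockTree_of_setPreconnected X.emb_isStrongBlock X.emb_injective X.emb_surjective
      X.base Function.Embedding.inl (fun j => ?_) Set.univ Set.univ_nonempty ?_
      fun _ _ => Set.subset_univ _
    · exact Set.range_comp X.base (X.emb j)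
    · have := (preconnected_iff_setPreconnected_range
        (SimpleGraph.Embedding.refl : X.G₀ ↪g X.G₀)).1 X.G₀_connected.preconnected
      rwa [show Set.range (SimpleGraph.Embedding.refl : X.G₀ ↪g X.G₀) = Set.univ from
        Set.range_id] at this
  have h1 : ∀ n ≤ Fintype.card E, BlockTree (fun i => Set.range (X.labels i)) (X.stage n)
      (F₀.disjSum (Finset.univ.filter fun f => (X.order f : ℕ) < n)) := by
    intro n
    induction n with
    | zero =>
      intro _
      rw [stage_zero]
      convert! h0
      ext (j | e) <;> simp
    | succ n ih =>
      intro hn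
      obtain ⟨e, rfl⟩ : ∃ e, (X.order e : ℕ) = n := ⟨X.order.symm ⟨n, hn⟩, by simp⟩
      obtain ⟨v, hv⟩ := X.attach e
      have := BlockTree.glue (blk := fun i => Set.range (X.labels i)) v (ih (by omega))
        (BlockTree.block (.inr e))
        (by simp only [Fin.lt_def] at hv; exact hv) (by simp)
      rw [stage_succ]
      convert! this using 1
      ext (j | f)
      · simp
      · simp [le_iff_lt_or_eq, or_comm, Fin.val_inj]
  refine ⟨_, X.stage_card ▸ h1 _ le_rfl, ?_⟩
  rintro (j | e) h
  · have : ¬ (Set.range (X.emb j)).Nontrivial := by simpa [F₀] using h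
    have := (Set.not_nontrivial_iff.1 this).image X.base
    rwa [← Set.range_comp] at this
  · simp at h

variable {X} in
omit [DecidableEq E] in
theorem kappaAt_eq (v₀ : X.V) :
    kappaAt X.Dstar X.D v₀ = principalMinor (reduced X.Dstar X.D v₀) (Set.univ \ {v₀}) := by
  have : (Set.univ \ {v₀} : Set X.V) = Set.range (Subtype.val : {v : X.V // v ≠ v₀} → X.V) := by
    ext; simp
  rw [this, principalMinor_range _ Subtype.val_injective]
  rfl

/-- The invariants of the distance matrix in terms of those of all blocks. -/
theorem invariants (h𝓑 : ∀ j, 1 ≤ (𝓑 j).size) (h𝓒 : ∀ e, 1 ≤ (𝓒 e).size) :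
    (∀ v₀, kappaAt X.Dstar X.D v₀ = ∏ i, (allData 𝓑 𝓒 i).kappa) ∧
    ∀ x : R, (X.D + x • allOnes X.V R).det = x * (∏ i, (allData 𝓑 𝓒 i).kappa) +
      ∑ i, (((allData 𝓑 𝓒 i).a - x) * (allData 𝓑 𝓒 i).rho) *
        ∏ f ∈ Finset.univ.erase i, (allData 𝓑 𝓒 f).kappa := by
  obtain ⟨F, hF, hFc⟩ := X.exists_blockTree
  have hsize : ∀ i, 1 ≤ (allData 𝓑 𝓒 i).size := by
    rintro (j | e)
    exacts [h𝓑 j, h𝓒 e]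
  have hone : ∀ i ∉ F, (allData 𝓑 𝓒 i).size = 1 := fun i hi =>
    BlockDatum.size_eq_one_of_subsingleton _ (hsize i) (X.labels_injective i) (hFc i hi)
  have hinter : ∀ e f, e ≠ f →
      (Set.range (X.labels e) ∩ Set.range (X.labels f)).Subsingleton := by
    intro e f hef
    by_cases he : e ∈ F
    · by_cases hf : f ∈ F
      · exact hF.inter_subsingleton e he f hf hef
      · exact (hFc f hf).anti Set.inter_subset_right
    · exact (hFc e he).anti Set.inter_subset_left
  have hreach : ∀ x y, X.G.Reachable x y := fun x y =>
    hF.reachable (fun e x hx y hy => X.reachable_of_labels e hx hy) x trivial y trivial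
  have hadj : ∀ x y, X.G.Adj x y →
      ∃ e ∈ F, x ∈ Set.range (X.labels e) ∧ y ∈ Set.range (X.labels e) := by
    intro x y hxy
    obtain ⟨i, hx, hy⟩ := X.adj_exists_labels hxy
    exact ⟨i, by_contra fun hi => hxy.ne (hFc i hi hx hy), hx, hy⟩
  obtain ⟨hκ, hdet⟩ := hF.invariants (M := X.Dstar) (D := X.D) hsize X.labels_injective
    (fun v => multDist_self v) (fun v => addMultDist_self v)
    (fun e s t => (distance_labels X.labels_injective hinter e s t).1)
    (fun e s t => (distance_labels X.labels_injective hinter e s t).2)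
    (fun v _ i _ j _ h => distance_rules (fun _ _ _ => X.not_isLabel_of_separates) v i j
      (h.separates hreach hadj))
  -- Blocks outside the tree `F` have one node, hence `kappa = 1`, and can be put back into the
  -- products.
  have hprod : ∀ T : Finset (Fin k ⊕ E),
      ∏ i ∈ F ∩ T, (allData 𝓑 𝓒 i).kappa = ∏ i ∈ T, (allData 𝓑 𝓒 i).kappa := fun T =>
    Finset.prod_subset Finset.inter_subset_right fun i hiT hi =>
      BlockDatum.kappa_of_size _ (hone i fun h => hi (Finset.mem_inter.2 ⟨h, hiT⟩))
  have hF' : ∏ i ∈ F, (allData 𝓑 𝓒 i).kappa = ∏ i, (allData 𝓑 𝓒 i).kappa := by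
    simpa using hprod Finset.univ
  refine ⟨fun v₀ => ?_, fun x => ?_⟩
  · rw [kappaAt_eq, hκ v₀ trivial, hF']
  · rw [← principalMinor_univ, hdet, hF']
    congr 1
    rw [← Finset.sum_subset (Finset.subset_univ F) fun i _ hi => by
      rw [BlockDatum.rho_of_size _ (hone i hi)]; simp]
    refine Finset.sum_congr rfl fun i _ => ?_
    rw [← hprod (Finset.univ.erase i), Finset.inter_erase, Finset.inter_univ]

end CliqueExtension

/-! ### The invariants of a clique -/

/-- A Lagrange-type identity: each summand is a symmetrization of `m v (m' v - m' w) (s v s w)`, so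
the sum runs over all ordered pairs, with vanishing diagonal. It rewrites the sum over `v < w` as
the products of sums occurring in a determinant of size two. -/
theorem sum_Ioi_sub_mul_sub {R : Type*} [CommRing R] {n : ℕ} (m m' s : Fin n → R) :
    ∑ v, ∑ w ∈ Finset.Ioi v, (m v - m w) * (m' v - m' w) * (s v * s w) =
      (∑ v, m v * m' v * s v) * (∑ v, s v) - (∑ v, m v * s v) * ∑ v, m' v * s v := by
  have h := Finset.sum_sum_Ioi_add_eq_sum_sum_off_diag
    (fun v w => m v * (m' v - m' w) * (s v * s w))
  have h1 : ∑ v, ∑ w ∈ Finset.Ioi v, (m v - m w) * (m' v - m' w) * (s v * s w) =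
      ∑ v, ∑ w, m w * (m' w - m' v) * (s w * s v) := by
    trans ∑ v, ∑ w ∈ ({v}ᶜ : Finset (Fin n)), m w * (m' w - m' v) * (s w * s v)
    · rw [← h]
      refine Finset.sum_congr rfl fun v _ => Finset.sum_congr rfl fun w _ => ?_
      ring
    · refine Finset.sum_congr rfl fun v _ => Finset.sum_subset (Finset.subset_univ _) ?_
      intro w _ hw
      obtain rfl : w = v := by simpa using hw
      ring
  rw [h1, Finset.sum_mul_sum, Finset.sum_mul_sum, Finset.sum_comm, ← Finset.sum_sub_distrib]
  refine Finset.sum_congr rfl fun v _ => ?_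
  rw [← Finset.sum_sub_distrib]
  refine Finset.sum_congr rfl fun w _ => ?_
  ring

theorem prod_erase_eq_mul_inverse {R ι : Type*} [CommRing R] [DecidableEq ι] {s : Finset ι}
    {t : ι → R} {v : ι} (hv : v ∈ s) (ht : IsUnit (t v)) :
    ∏ w ∈ s.erase v, t w = (∏ w ∈ s, t w) * Ring.inverse (t v) := by
  rw [← Finset.mul_prod_erase s t hv, mul_right_comm, Ring.mul_inverse_cancel _ ht, one_mul]

namespace CliqueDatum

variable {R : Type*} [CommRing R] (C : CliqueDatum R)

/-- The matrix `D*` of the clique. -/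
def star : Matrix (Fin C.size) (Fin C.size) R :=
  Matrix.of fun v w => if v = w then 1 else C.m v * C.m' w

theorem toBlockDatum_kappa : C.toBlockDatum.kappa = C.a ^ (C.size - 1) * C.star.det := rfl

theorem toBlockDatum_rho :
    C.toBlockDatum.rho = C.a ^ (C.size - 1) * (C.star - allOnes _ R).det := rfl

section Units

variable {C} (ht : ∀ v, IsUnit (1 - C.m v * C.m' v))
include ht

theorem kappa_eq_of_isUnit :
    C.kappa = C.a ^ (C.size - 1) * (1 + C.sumD) * ∏ v, (1 - C.m v * C.m' v) := by
  rw [kappa, sumD, mul_assoc, add_mul, one_mul, Finset.sum_mul]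
  congr 2
  refine Finset.sum_congr rfl fun v _ => ?_
  rw [prod_erase_eq_mul_inverse (Finset.mem_univ v) (ht v)]
  ring

theorem sigma_eq_of_isUnit :
    C.sigma = C.a ^ (C.size - 1) * (∏ v, (1 - C.m v * C.m' v)) * C.sumS := by
  rw [sigma, sumS, mul_assoc (C.a ^ _), mul_add (∏ v, (1 - C.m v * C.m' v)),
    mul_comm ((C.size : R) - 1), Finset.mul_sum]
  refine congrArg _ (congrArg _ (Finset.sum_congr rfl fun v _ => ?_))
  rw [Finset.mul_sum]
  refine Finset.sum_congr rfl fun w hw => ?_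
  rw [prod_erase_eq_mul_inverse (t := fun u => 1 - C.m u * C.m' u) (Finset.mem_erase.2 ⟨(Finset.mem_Ioi.1 hw).ne',
    Finset.mem_univ w⟩) (ht w), prod_erase_eq_mul_inverse (Finset.mem_univ v) (ht v)]
  ring

/-- Sylvester's identity for a diagonal matrix perturbed by rank at most `n`, used with `n = 1` for
`D*` and `n = 2` for `D* - J`. -/
theorem det_one_add_of_isUnit {n : ℕ} (U : Matrix (Fin C.size) (Fin n) R)
    (W : Matrix (Fin n) (Fin C.size) R) :
    (Matrix.diagonal (fun v => 1 - C.m v * C.m' v) + U * W).det =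
      (∏ v, (1 - C.m v * C.m' v)) *
        (1 + Matrix.of fun i j => ∑ v, W i v * U v j * Ring.inverse (1 - C.m v * C.m' v)).det := by
  have hu : IsUnit (Matrix.diagonal (fun v => 1 - C.m v * C.m' v)).det := by
    rw [Matrix.det_diagonal]
    exact (IsUnit.prod_univ_iff (f := fun v => 1 - C.m v * C.m' v)).2 ht
  rw [Matrix.det_add_mul U W hu, Matrix.det_diagonal, Matrix.inv_diagonal]
  congr 3
  ext i j
  rw [Matrix.mul_apply, Matrix.of_apply]
  refine Finset.sum_congr rfl fun v _ => ?_
  have hinv : Ring.inverse (fun v => 1 - C.m v * C.m' v) v =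
      Ring.inverse (1 - C.m v * C.m' v) := by
    have hu' : IsUnit (fun v => 1 - C.m v * C.m' v) := Pi.isUnit_iff.2 ht
    exact (left_inv_eq_right_inv (Ring.inverse_mul_cancel _ (ht v))
      (congrFun (Ring.mul_inverse_cancel _ hu') v)).symm
  rw [Matrix.mul_diagonal, hinv]
  ring

theorem det_star_of_isUnit :
    C.star.det = (1 + C.sumD) * ∏ v, (1 - C.m v * C.m' v) := by
  have h := det_one_add_of_isUnit ht (Matrix.replicateCol (Fin 1) C.m)
    (Matrix.replicateRow (Fin 1) C.m')
  have hD : C.star = Matrix.diagonal (fun v => 1 - C.m v * C.m' v) +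
      Matrix.replicateCol (Fin 1) C.m * Matrix.replicateRow (Fin 1) C.m' := by
    ext v w
    by_cases hvw : v = w
    · subst hvw; simp [star, Matrix.mul_apply]
    · simp [star, Matrix.mul_apply, hvw]
  rw [hD, h, Matrix.det_fin_one, mul_comm]
  simp [sumD, mul_comm]

theorem det_star_sub_of_isUnit :
    (C.star - allOnes _ R).det = -((∏ v, (1 - C.m v * C.m' v)) * C.sumS) := by
  have h := det_one_add_of_isUnit ht (Matrix.of fun v => ![C.m v, -1])
    (Matrix.of ![C.m', fun _ => 1])
  have hD : C.star - allOnes _ R = Matrix.diagonal (fun v => 1 - C.m v * C.m' v) +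
      (Matrix.of fun v => ![C.m v, -1]) * (Matrix.of ![C.m', fun _ => 1]) := by
    ext v w
    by_cases hvw : v = w
    · subst hvw; simp [star, Matrix.mul_apply, allOnes]; ring
    · simp [star, Matrix.mul_apply, hvw, allOnes, sub_eq_add_neg]
  -- With `t = 1 - m m'` one has `1 / t = 1 + m m' / t`; summing over the nodes produces the size.
  have hsum : ∑ v, Ring.inverse (1 - C.m v * C.m' v) = C.size + C.sumD := by
    have : ∀ v, Ring.inverse (1 - C.m v * C.m' v) =
        1 + C.m v * C.m' v * Ring.inverse (1 - C.m v * C.m' v) := by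
      intro v
      have := Ring.mul_inverse_cancel _ (ht v)
      linear_combination this
    rw [Finset.sum_congr rfl fun v _ => this v, Finset.sum_add_distrib, sumD]
    simp
  have h2 := sum_Ioi_sub_mul_sub C.m C.m' fun v => Ring.inverse (1 - C.m v * C.m' v)
  rw [hD, h, Matrix.det_fin_two, sumS, h2, hsum]
  simp only [Matrix.add_apply, Matrix.one_apply, Matrix.of_apply, Matrix.cons_val_zero,
    Matrix.cons_val_one, Fin.isValue, if_true, zero_ne_one, one_ne_zero, if_false, one_mul,
    mul_neg, mul_one, neg_mul, Finset.sum_neg_distrib, hsum]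
  have h3 : ∑ v, C.m' v * C.m v * Ring.inverse (1 - C.m v * C.m' v) = C.sumD := by
    simp [sumD, mul_comm]
  rw [h3, ← sumD]
  ring

theorem toBlockDatum_of_isUnit :
    C.toBlockDatum.kappa = C.kappa ∧ C.toBlockDatum.rho = -C.sigma := by
  rw [kappa_eq_of_isUnit ht, sigma_eq_of_isUnit ht, toBlockDatum_kappa, toBlockDatum_rho,
    det_star_of_isUnit ht, det_star_sub_of_isUnit ht]
  constructor <;> ring

end Units

variable {S : Type*} [CommRing S] (f : R →+* S)

/-- Change of rings. -/
def map : CliqueDatum S where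
  size := C.size
  a := f C.a
  m v := f (C.m v)
  m' v := f (C.m' v)

theorem kappa_map : (C.map f).kappa = f C.kappa := by
  simp only [kappa, map, map_mul, map_pow, map_add, map_prod, map_sum, map_sub, map_one]
  rfl

theorem sigma_map : (C.map f).sigma = f C.sigma := by
  simp only [sigma, map, map_mul, map_pow, map_add, map_prod, map_sum, map_sub, map_one,
    map_natCast]
  rfl

theorem star_map : (C.map f).star = f.mapMatrix C.star := by
  ext v w
  change (if v = w then (1 : S) else f (C.m v) * f (C.m' w)) =
    f (if v = w then 1 else C.m v * C.m' w)
  rw [apply_ite f, map_one, map_mul]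

theorem toBlockDatum_kappa_map :
    (C.map f).toBlockDatum.kappa = f C.toBlockDatum.kappa := by
  rw [toBlockDatum_kappa, toBlockDatum_kappa, star_map, map_mul, map_pow, RingHom.map_det]
  rfl

theorem toBlockDatum_rho_map :
    (C.map f).toBlockDatum.rho = f C.toBlockDatum.rho := by
  have : allOnes (Fin C.size) S = f.mapMatrix (allOnes (Fin C.size) R) := by
    ext; simp [allOnes]
  rw [toBlockDatum_rho, toBlockDatum_rho, star_map, map_mul, map_pow, RingHom.map_det, map_sub,
    ← this]
  rfl

/-- The clique-datum on `n` nodes whose entries are independent variables. -/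
noncomputable def generic (n : ℕ) : CliqueDatum (MvPolynomial (Option (Fin n ⊕ Fin n)) ℤ) where
  size := n
  a := MvPolynomial.X none
  m v := MvPolynomial.X (some (.inl v))
  m' v := MvPolynomial.X (some (.inr v))

theorem generic_ne_zero {n : ℕ} (v : Fin n) :
    1 - (generic n).m v * (generic n).m' v ≠ 0 := by
  intro h
  have := congrArg (MvPolynomial.eval fun _ => (0 : ℤ)) h
  simp [generic] at this

/-- The invariants of a clique as a block. -/
theorem toBlockDatum_kappa_rho :
    C.toBlockDatum.kappa = C.kappa ∧ C.toBlockDatum.rho = -C.sigma := by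
  obtain ⟨n, a, m, m'⟩ := C
  let P := MvPolynomial (Option (Fin n ⊕ Fin n)) ℤ
  -- Both identities are polynomial over ℤ in `a`, `m`, `m'`. In the fraction field every `1 - m v *
  -- m' v` is a unit, so the earlier case applies; the identities are pulled back to `P` and
  -- specialized to `R`.
  have hinj := IsFractionRing.injective P (FractionRing P)
  have h1 : (generic n).toBlockDatum.kappa = (generic n).kappa ∧
      (generic n).toBlockDatum.rho = -(generic n).sigma := by
    have := toBlockDatum_of_isUnit (C := (generic n).map (algebraMap P (FractionRing P)))
      fun v => by
        have h := (map_ne_zero_iff (algebraMap P (FractionRing P)) hinj).2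
          (generic_ne_zero (n := n) v)
        rw [map_sub, map_mul, map_one] at h
        exact isUnit_iff_ne_zero.2 h
    rw [kappa_map, sigma_map, toBlockDatum_kappa_map, toBlockDatum_rho_map, ← map_neg] at this
    exact ⟨hinj this.1, hinj this.2⟩
  let g : P →+* R := MvPolynomial.eval₂Hom (Int.castRingHom R)
    fun o => o.elim a (Sum.elim m m')
  have hg : (⟨n, a, m, m'⟩ : CliqueDatum R) = (generic n).map g := by
    simp only [map, generic, g, MvPolynomial.coe_eval₂Hom, MvPolynomial.eval₂_X]
    rfl
  rw [hg, toBlockDatum_kappa_map, toBlockDatum_rho_map, kappa_map, sigma_map, h1.1, h1.2, map_neg]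
  exact ⟨rfl, rfl⟩

end CliqueDatum

/-! ### The formulas in terms of the blocks and the cliques -/

theorem sum_mul_prod_erase_sum {R α β : Type*} [CommRing R] [Fintype α] [Fintype β]
    [DecidableEq α] [DecidableEq β] (c κ : α ⊕ β → R) :
    ∑ i, c i * ∏ f ∈ Finset.univ.erase i, κ f =
      (∑ j, c (.inl j) * ∏ i ∈ Finset.univ.erase j, κ (.inl i)) * (∏ e, κ (.inr e)) +
      (∏ j, κ (.inl j)) * ∑ e, c (.inr e) * ∏ f ∈ Finset.univ.erase e, κ (.inr f) := by
  have hl : ∀ j : α, (Finset.univ : Finset (α ⊕ β)).erase (.inl j) =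
      (Finset.univ.erase j).disjSum Finset.univ := by
    intro j; ext (x | x) <;> simp
  have hr : ∀ e : β, (Finset.univ : Finset (α ⊕ β)).erase (.inr e) =
      Finset.univ.disjSum (Finset.univ.erase e) := by
    intro j; ext (x | x) <;> simp
  simp only [Fintype.sum_sum_type, hl, hr, Finset.prod_disjSum, Finset.sum_mul, Finset.mul_sum,
    mul_assoc, mul_left_comm]

theorem sum_mul_prod_erase_of_eq_mul {R α : Type*} [CommRing R] [Fintype α] [DecidableEq α]
    {c κ ρ u : α → R} (h : ∀ i, ρ i = κ i * u i) :
    ∑ i, c i * ρ i * ∏ j ∈ Finset.univ.erase i, κ j = (∏ i, κ i) * ∑ i, c i * u i := by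
  rw [Finset.mul_sum]
  refine Finset.sum_congr rfl fun i _ => ?_
  rw [← Finset.mul_prod_erase Finset.univ κ (Finset.mem_univ i), h]
  ring

namespace CliqueExtension

variable {R : Type*} [CommRing R] {k : ℕ} {𝓑 : Fin k → BlockDatum R} {E : Type w} [Fintype E]
  [DecidableEq E] {𝓒 : E → CliqueDatum R}
  (X : CliqueExtension.{u, w} (fun j => (𝓑 j).size) (fun e => (𝓒 e).size))

theorem formulas (h𝓑 : ∀ j, 1 ≤ (𝓑 j).size) (h𝓒 : ∀ e, 2 ≤ (𝓒 e).size) :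
    (∀ v₀ : X.V, kappaAt X.Dstar X.D v₀ = (∏ j, (𝓑 j).kappa) * ∏ e, (𝓒 e).kappa) ∧
    cofSum X.D =
      (∏ j, (𝓑 j).kappa) * (∏ e, (𝓒 e).kappa)
      - (∑ j, (𝓑 j).rho * ∏ i ∈ Finset.univ.erase j, (𝓑 i).kappa) * (∏ e, (𝓒 e).kappa)
      + (∏ j, (𝓑 j).kappa) * ∑ e, (𝓒 e).sigma * ∏ f ∈ Finset.univ.erase e, (𝓒 f).kappa ∧
    ∀ x : R, (X.D + x • allOnes X.V R).det =
      x * ((∏ j, (𝓑 j).kappa) * ∏ e, (𝓒 e).kappa)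
      + (∑ j, ((𝓑 j).a - x) * (𝓑 j).rho * ∏ i ∈ Finset.univ.erase j, (𝓑 i).kappa) *
        (∏ e, (𝓒 e).kappa)
      + (∏ j, (𝓑 j).kappa) *
        ∑ e, (x - (𝓒 e).a) * (𝓒 e).sigma * ∏ f ∈ Finset.univ.erase e, (𝓒 f).kappa := by
  obtain ⟨hκ, hdet⟩ := X.invariants h𝓑 fun e => one_le_two.trans (h𝓒 e)
  have hprod : ∏ i, (allData 𝓑 𝓒 i).kappa = (∏ j, (𝓑 j).kappa) * ∏ e, (𝓒 e).kappa := by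
    rw [Fintype.prod_sum_type]
    congr 1
    exact Finset.prod_congr rfl fun e _ => (𝓒 e).toBlockDatum_kappa_rho.1
  have hdet' : ∀ x : R, (X.D + x • allOnes X.V R).det =
      x * ((∏ j, (𝓑 j).kappa) * ∏ e, (𝓒 e).kappa)
      + (∑ j, ((𝓑 j).a - x) * (𝓑 j).rho * ∏ i ∈ Finset.univ.erase j, (𝓑 i).kappa) *
        (∏ e, (𝓒 e).kappa)
      + (∏ j, (𝓑 j).kappa) *
        ∑ e, (x - (𝓒 e).a) * (𝓒 e).sigma * ∏ f ∈ Finset.univ.erase e, (𝓒 f).kappa := by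
    intro x
    rw [hdet, hprod, sum_mul_prod_erase_sum, add_assoc]
    have hc : ∀ e, (allData 𝓑 𝓒 (.inr e)).kappa = (𝓒 e).kappa := fun e =>
      (𝓒 e).toBlockDatum_kappa_rho.1
    have hρ : ∀ e, ((allData 𝓑 𝓒 (.inr e)).a - x) * (allData 𝓑 𝓒 (.inr e)).rho =
        (x - (𝓒 e).a) * (𝓒 e).sigma := by
      intro e
      change ((𝓒 e).a - x) * (𝓒 e).toBlockDatum.rho = _
      -- The sign in `rho = -sigma` turns the factor `a - x` of a general block into `x - a` for a
      -- clique.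
      rw [(𝓒 e).toBlockDatum_kappa_rho.2]
      ring
    simp only [hc, hρ]
    rfl
  refine ⟨fun v₀ => (hκ v₀).trans hprod, ?_, hdet'⟩
  rw [cofSum_eq_sub, hdet', hdet']
  simp only [sub_mul, one_mul, zero_mul, Finset.sum_sub_distrib, Finset.sum_const_zero]
  ring

end CliqueExtension

namespace BlockDatum

variable {R : Type*} [CommRing R] {B : BlockDatum R} {d : R}

theorem kappa_eq_mul_rho (hd : B.D *ᵥ (fun _ => (1 : R)) = d • (fun _ => (1 : R)))
    (hu : IsUnit d) : B.kappa = (1 + B.a * B.size * Ring.inverse d) * B.rho := by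
  have h1 := B.d_mul_kappa hd
  have h2 := Ring.mul_inverse_cancel _ hu
  linear_combination (Ring.inverse d) * h1 + (B.rho - B.kappa) * h2

theorem kappa_eq_det_mul (h : 1 ≤ B.size)
    (hd : B.D *ᵥ (fun _ => (1 : R)) = d • (fun _ => (1 : R))) (ha : IsUnit B.a)
    (hu : IsUnit d) :
    B.kappa = B.D.det * (Ring.inverse B.a + B.size * Ring.inverse d) := by
  rw [kappa_eq_mul_rho hd hu, ← B.a_mul_rho h]
  linear_combination (-B.rho) * Ring.mul_inverse_cancel _ ha

end BlockDatum

end AddMultDist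

theorem mainTheorem9 {R : Type*} [CommRing R] {k : ℕ} (hk : 1 ≤ k)
    (𝓑 : Fin k → AddMultDist.BlockDatum R) (h𝓑 : ∀ j, 1 ≤ (𝓑 j).size)
    (d : Fin k → R)
    (hd : ∀ j, (𝓑 j).D *ᵥ (fun _ => (1 : R)) = d j • (fun _ => (1 : R)))
    {E : Type*} [Fintype E] [DecidableEq E]
    (𝓒 : E → AddMultDist.CliqueDatum R) (h𝓒 : ∀ e, 2 ≤ (𝓒 e).size) :
    -- The formulas over an arbitrary commutative ring, with the denominators cancelled.
    (∀ X : AddMultDist.CliqueExtension (fun j => (𝓑 j).size) (fun e => (𝓒 e).size),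
      (∀ v₀ : X.V, AddMultDist.kappaAt X.Dstar X.D v₀ =
        (∏ j, (𝓑 j).kappa) * ∏ e, (𝓒 e).kappa) ∧
      AddMultDist.cofSum X.D =
        (∏ j, (𝓑 j).kappa) * (∏ e, (𝓒 e).kappa)
        - (∑ j, (𝓑 j).rho * ∏ i ∈ Finset.univ.erase j, (𝓑 i).kappa) * (∏ e, (𝓒 e).kappa)
        + (∏ j, (𝓑 j).kappa) *
          ∑ e, (𝓒 e).sigma * ∏ f ∈ Finset.univ.erase e, (𝓒 f).kappa ∧
      ∀ x : R, (X.D + x • AddMultDist.allOnes X.V R).det =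
        x * ((∏ j, (𝓑 j).kappa) * ∏ e, (𝓒 e).kappa)
        + (∑ j, ((𝓑 j).a - x) * (𝓑 j).rho * ∏ i ∈ Finset.univ.erase j, (𝓑 i).kappa) *
          (∏ e, (𝓒 e).kappa)
        + (∏ j, (𝓑 j).kappa) *
          ∑ e, (x - (𝓒 e).a) * (𝓒 e).sigma * ∏ f ∈ Finset.univ.erase e, (𝓒 f).kappa) ∧
    -- How the cancelled quantities of the blocks depend on `d j`.
    (∀ j, (𝓑 j).a * (𝓑 j).rho = (𝓑 j).D.det ∧
      d j * (𝓑 j).kappa = (d j + (𝓑 j).a * (𝓑 j).size) * (𝓑 j).rho) ∧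
    -- The formulas as they stand, whenever all denominators are invertible.
    ((∀ j, IsUnit (𝓑 j).a) → (∀ j, IsUnit (d j)) →
      (∀ j, IsUnit (1 + (𝓑 j).a * (𝓑 j).size * Ring.inverse (d j))) →
      (∀ e v, IsUnit (1 - (𝓒 e).m v * (𝓒 e).m' v)) → (∀ e, IsUnit (1 + (𝓒 e).sumD)) →
      ∃ K : R,
        K = (∏ j, (𝓑 j).D.det *
              (Ring.inverse (𝓑 j).a + (𝓑 j).size * Ring.inverse (d j))) *
            (∏ e, (𝓒 e).a ^ ((𝓒 e).size - 1) * (1 + (𝓒 e).sumD) *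
              ∏ v, (1 - (𝓒 e).m v * (𝓒 e).m' v)) ∧
        ∀ X : AddMultDist.CliqueExtension (fun j => (𝓑 j).size) (fun e => (𝓒 e).size),
          (∀ v₀ : X.V, AddMultDist.kappaAt X.Dstar X.D v₀ = K) ∧
          AddMultDist.cofSum X.D = K *
            (1 - ∑ j, Ring.inverse (1 + (𝓑 j).a * (𝓑 j).size * Ring.inverse (d j))
              + ∑ e, Ring.inverse (1 + (𝓒 e).sumD) * (𝓒 e).sumS) ∧
          ∀ x : R, (X.D + x • AddMultDist.allOnes X.V R).det = K *
            (x + ∑ j, ((𝓑 j).a - x) *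
                Ring.inverse (1 + (𝓑 j).a * (𝓑 j).size * Ring.inverse (d j))
              + ∑ e, (x - (𝓒 e).a) * Ring.inverse (1 + (𝓒 e).sumD) * (𝓒 e).sumS)) ∧
    -- Independence of the structure and of the locations of the blocks and the cliques.
    (∀ X Y : AddMultDist.CliqueExtension (fun j => (𝓑 j).size) (fun e => (𝓒 e).size),
      X.D.det = Y.D.det ∧ AddMultDist.cofSum X.D = AddMultDist.cofSum Y.D ∧
      ∀ (v₀ : X.V) (w₀ : Y.V),
        AddMultDist.kappaAt X.Dstar X.D v₀ = AddMultDist.kappaAt Y.Dstar Y.D w₀) := by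
  refine ⟨fun X => X.formulas h𝓑 h𝓒,
    fun j => ⟨(𝓑 j).a_mul_rho (h𝓑 j), (𝓑 j).d_mul_kappa (hd j)⟩, ?_, ?_⟩
  · intro ha hdu hju htu hsu
    have hB : ∏ j, (𝓑 j).D.det * (Ring.inverse (𝓑 j).a + (𝓑 j).size * Ring.inverse (d j)) =
        ∏ j, (𝓑 j).kappa := Finset.prod_congr rfl fun j _ =>
      (AddMultDist.BlockDatum.kappa_eq_det_mul (h𝓑 j) (hd j) (ha j) (hdu j)).symm
    have hC : ∏ e, (𝓒 e).a ^ ((𝓒 e).size - 1) * (1 + (𝓒 e).sumD) *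
        ∏ v, (1 - (𝓒 e).m v * (𝓒 e).m' v) = ∏ e, (𝓒 e).kappa :=
      Finset.prod_congr rfl fun e _ => (AddMultDist.CliqueDatum.kappa_eq_of_isUnit (htu e)).symm
    -- Writing `rho` and `sigma` as multiples of `kappa` lets the full product `K` be pulled out of
    -- the cancelled formulas.
    have hρ : ∀ j, (𝓑 j).rho = (𝓑 j).kappa *
        Ring.inverse (1 + (𝓑 j).a * (𝓑 j).size * Ring.inverse (d j)) := by
      intro j
      rw [AddMultDist.BlockDatum.kappa_eq_mul_rho (hd j) (hdu j), mul_right_comm,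
        Ring.mul_inverse_cancel _ (hju j), one_mul]
    have hσ : ∀ e, (𝓒 e).sigma = (𝓒 e).kappa *
        (Ring.inverse (1 + (𝓒 e).sumD) * (𝓒 e).sumS) := by
      intro e
      rw [AddMultDist.CliqueDatum.kappa_eq_of_isUnit (htu e),
        AddMultDist.CliqueDatum.sigma_eq_of_isUnit (htu e)]
      linear_combination (-(𝓒 e).a ^ ((𝓒 e).size - 1) * (∏ v, (1 - (𝓒 e).m v * (𝓒 e).m' v)) *
        (𝓒 e).sumS) * Ring.mul_inverse_cancel _ (hsu e)
    refine ⟨_, rfl, fun X => ?_⟩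
    obtain ⟨h1, h2, h3⟩ := X.formulas h𝓑 h𝓒
    rw [hB, hC]
    refine ⟨h1, ?_, fun x => ?_⟩
    · have e1 := AddMultDist.sum_mul_prod_erase_of_eq_mul (c := fun _ => 1) hρ
      have e2 := AddMultDist.sum_mul_prod_erase_of_eq_mul (c := fun _ => 1) hσ
      simp only [one_mul] at e1 e2
      rw [h2, e1, e2]
      ring
    · rw [h3, AddMultDist.sum_mul_prod_erase_of_eq_mul hρ,
        AddMultDist.sum_mul_prod_erase_of_eq_mul hσ]
      simp only [mul_assoc]
      ring
  · intro X Y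
    obtain ⟨h1, h2, h3⟩ := X.formulas h𝓑 h𝓒
    obtain ⟨h1', h2', h3'⟩ := Y.formulas h𝓑 h𝓒
    refine ⟨?_, h2.trans h2'.symm, fun v₀ w₀ => (h1 v₀).trans (h1' w₀).symm⟩
    have := (h3 0).trans (h3' 0).symm
    simpa only [zero_smul, add_zero] using this
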